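/- \textbf{Theorem.} Let $\nu\ge 0$ and let $(U(x,t))_{x\in\mathbb R^3,\,t\ge 0}$ be an $\mathbb R^3$-valued random field on a probability space $(\Omega,\mathcal F,\mathbb P)$ such that every sample path solves, with some pressure $P$, the incompressible Navier--Stokes equations (Euler equations if $\nu=0$) $$\partial_t U^i+U^j\partial_{x^j}U^i=\nu\Delta_x U^i-\partial_{x^i}P,\qquad \partial_{x^j}U^j=0\qquad (x\in\mathbb R^3,\ t>0),\qquad U(x,0)=U_0(x).$$ (Repeated indices are summed over $1,2,3$.) Assume the following smoothness and decay. Each path $U$ is continuous on $\mathbb R^3\times[0,\infty)$ and $C^3$ on $\mathbb R^3\times(0,\infty)$; $P$ is $C^2$ on $\mathbb R^3\times(0,\infty)$ and $P(x,t)\to 0$ as $|x|\to\infty$ for each $t>0$. For some $\alpha>\tfrac12$ and every $[a,b]\subset(0,\infty)$ there is a random variable $Z\in L^2(\mathbb P)$ such that, for all $t\in[a,b]$ and $x\in\mathbb R^3$, the components of $U$ and of its first and second spatial derivatives are bounded in absolute value by $Z(1+|x|)^{-\alpha}$. For $t>0$ let $\rho^i(x,y,u,t)$ be a version of $\mathbb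 E[U^i(y,t)-U^i(x,t)\mid U(x,t)=u]$, put $b^i=\rho^i+u^i$, and let $\sigma^{ij}(x,y,u,t)$ be a version of the conditional covariance of $U^i(y,t)$ and $U^j(y,t)$ given $U(x,t)=u$. Put $$B^i_k(x,u,t)=\partial_{y^k}\rho^i\big|_{y=x},\qquad A^i_{jk}(x,u,t)=\partial_{y^j}\partial_{y^k}\rho^i\big|_{y=x},\qquad A^i=A^i_{kk}=\Delta_y\rho^i\big|_{y=x},$$ $$Q^i(x,u,t)=\int_{\mathbb R^3}\frac{y^i-x^i}{4\pi|y-x|^3}\,\frac{\partial^2(\sigma^{jk}+b^jb^k)}{\partial y^k\partial y^j}\,dy .$$ Assume that $U$ is regular: for $t>0$, $\rho$ is twice differentiable in $y$, $$\rho=B_k(y^k-x^k)+\tfrac12A_{jk}(y^j-x^j)(y^k-x^k)+o(|y-x|^2)\quad\text{as } y\to x,$$ and $B^i_k$, $A^i_{jk}$ are differentiable in $(x,u,t)$. Assume moreover that, for each $t>0$, $B^i_k$ is $C^1$ in $(x,u)$ and $\sigma^{jk}$ is twice differentiable in $y$. Assume finally that for every $x$ and every $t\ge0$, $U(x,t)$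 has a probability density $p(u;x,t)$, that $p$ is of class $C^{1,2,1}$ in $(u,x,t)$ for $t>0$ (jointly $C^1$, and $C^2$ in $x$ with second $x$-derivatives continuous in $(u,x,t)$), and let $p_0(u;x)$ be the density of $U_0(x)$. Then $p$ satisfies $$\partial_t p+u^i\partial_{x^i}p=\nu\Delta_xp+\partial_{u^i}G^i,\qquad G^i:=\nu\,\partial_{x^k}(pB^i_k)-\nu pA^i+pQ^i,\qquad p(u;x,0)=p_0(u;x),$$ in the following sense. For all $x\in\mathbb R^3$ and $t>0$: the integral defining $Q^i(x,u,t)$ converges absolutely for almost every $u$ with respect to the law of $U(x,t)$; $G^i(x,\cdot,t)$ is locally integrable; for every $F\in C_c^\infty(\mathbb R^3)$, $$\int_{\mathbb R^3} F\,(\partial_tp+u^i\partial_{x^i}p-\nu\Delta_xp)\,du=-\int_{\mathbb R^3} \partial_{u^i}F\;G^i\,du ;$$ and the equation holds pointwise at every $u$ at which $G^1,G^2,G^3$ are differentiable in $u$. Moreover, for every $x$, $p(u;x,0)=p_0(u;x)$ for almost every $u$, and $\int F\,p(u;x,t)\,du\to\int F\,p_0(u;x)\,du$ as $t\downarrow0$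 for every bounded continuous $F$. -/

import Mathlib

open MeasureTheory Filter Topology Asymptotics Set

namespace TurbPDF

/-- Euclidean three-space. -/
abbrev E3 : Type := EuclideanSpace ℝ (Fin 3)

/-- The partial derivative of `f` in the `k`-th coordinate direction at the point `x`. -/
noncomputable def pd (k : Fin 3) (f : E3 → ℝ) (x : E3) : ℝ :=
  lineDeriv ℝ f x (EuclideanSpace.single k 1)

/-- The Laplacian, the sum of the pure second partial derivatives. -/
noncomputable def lap (f : E3 → ℝ) (x : E3) : ℝ :=
  ∑ k : Fin 3, pd k (pd k f) x

/-- `f` has (total) derivatives up to second order everywhere. -/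
def TwiceDifferentiable (f : E3 → ℝ) : Prop :=
  Differentiable ℝ f ∧ Differentiable ℝ (fderiv ℝ f)

/-- `V`, `Pr` solve the incompressible Navier-Stokes equations on the whole space with
viscosity `ν` (`ν = 0`: Euler) for positive times, with initial velocity `V₀`. -/
structure SolvesNavierStokes (ν : ℝ) (V : E3 → ℝ → E3) (Pr : E3 → ℝ → ℝ) (V₀ : E3 → E3) :
    Prop where
  momentum : ∀ x t, 0 < t → ∀ i : Fin 3,
    deriv (fun s => V x s i) t + ∑ j : Fin 3, V x t j * pd j (fun y => V y t i) x
      = ν * lap (fun y => V y t i) x - pd i (fun y => Pr y t) x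
  incompressible : ∀ x t, 0 < t → ∑ j : Fin 3, pd j (fun y => V y t j) x = 0
  initial : ∀ x, V x 0 = V₀ x

/-- Velocity and pressure are smooth enough functions of `(x, t)`; the velocity is continuous up
to time zero and the pressure tends to zero at spatial infinity. -/
structure SmoothDecaying (V : E3 → ℝ → E3) (Pr : E3 → ℝ → ℝ) : Prop where
  velocity_continuous : ContinuousOn (fun z : E3 × ℝ => V z.1 z.2) (univ ×ˢ Ici 0)
  velocity_smooth : ContDiffOn ℝ 3 (fun z : E3 × ℝ => V z.1 z.2) (univ ×ˢ Ioi 0)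
  pressure_smooth : ContDiffOn ℝ 2 (fun z : E3 × ℝ => Pr z.1 z.2) (univ ×ˢ Ioi 0)
  pressure_decay : ∀ t, 0 < t → Tendsto (fun x => Pr x t) (cocompact E3) (𝓝 0)

section Random

variable {Ω : Type*} [MeasurableSpace Ω]

/-- Locally uniformly in positive time, the velocity and its spatial derivatives up to second
order are bounded by `Z (1 + |x|) ^ (-α)` for some square integrable random variable `Z`. -/
def HasDecayEnvelope (μ : Measure Ω) (α : ℝ) (U : E3 → ℝ → Ω → E3) : Prop :=
  ∀ a b : ℝ, 0 < a → a ≤ b → ∃ Z : Ω → ℝ, MemLp Z 2 μ ∧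
    ∀ ω, ∀ t ∈ Icc a b, ∀ x : E3, ∀ i j k : Fin 3,
      |U x t ω i| ≤ Z ω * (1 + ‖x‖) ^ (-α) ∧
      |pd j (fun y => U y t ω i) x| ≤ Z ω * (1 + ‖x‖) ^ (-α) ∧
      |pd k (pd j (fun y => U y t ω i)) x| ≤ Z ω * (1 + ‖x‖) ^ (-α)

/-- `q` is a probability density function (with respect to Lebesgue measure) of `X`. -/
def IsPDF (μ : Measure Ω) (X : Ω → E3) (q : E3 → ℝ) : Prop :=
  (∀ u, 0 ≤ q u) ∧ Measurable q ∧
    μ.map X = (volume : Measure E3).withDensity (fun u => ENNReal.ofReal (q u))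

/-- `g` is a version of the conditional expectation `u ↦ E[Y | X = u]`. -/
def IsCondExpGiven (μ : Measure Ω) (X : Ω → E3) (Y : Ω → ℝ) (g : E3 → ℝ) : Prop :=
  Integrable Y μ ∧ Measurable g ∧
    (fun ω => g (X ω)) =ᵐ[μ] μ[Y | MeasurableSpace.comap X inferInstance]

/-- The conditional mean `b = ρ + u` belonging to the conditional average increment `ρ`. -/
noncomputable def condMean (ρ : E3 → E3 → E3 → ℝ → E3) (x y u : E3) (t : ℝ) (i : Fin 3) : ℝ :=
  ρ x y u t i + u i

/-- `ρ x y u t i` is a version of `E[Uⁱ(y,t) - Uⁱ(x,t) | U(x,t) = u]`, for `t > 0`. -/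
def IsCondIncrement (μ : Measure Ω) (U : E3 → ℝ → Ω → E3) (ρ : E3 → E3 → E3 → ℝ → E3) : Prop :=
  ∀ x y t, 0 < t → ∀ i : Fin 3,
    IsCondExpGiven μ (U x t) (fun ω => U y t ω i - U x t ω i) (fun u => ρ x y u t i)

/-- `σ x y u t i j` is a version of the conditional covariance of `Uⁱ(y,t)` and `Uʲ(y,t)` given
`U(x,t) = u`, for `t > 0`. -/
def IsCondCovariance (μ : Measure Ω) (U : E3 → ℝ → Ω → E3) (ρ : E3 → E3 → E3 → ℝ → E3)
    (σ : E3 → E3 → E3 → ℝ → Fin 3 → Fin 3 → ℝ) : Prop :=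
  ∀ x y t, 0 < t → ∀ i j : Fin 3,
    IsCondExpGiven μ (U x t)
      (fun ω => (U y t ω i - condMean ρ x y (U x t ω) t i) *
        (U y t ω j - condMean ρ x y (U x t ω) t j))
      (fun u => σ x y u t i j)

end Random

/-- `Bⁱ_k(x,u,t)`, the derivative of `ρⁱ` in `y^k` at `y = x`. -/
noncomputable def coeffB (ρ : E3 → E3 → E3 → ℝ → E3) (i k : Fin 3) (x u : E3) (t : ℝ) : ℝ :=
  pd k (fun y => ρ x y u t i) x

/-- `Aⁱ_{jk}(x,u,t)`, the second derivative of `ρⁱ` in `y^j`, `y^k` at `y = x`. -/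
noncomputable def coeffA2 (ρ : E3 → E3 → E3 → ℝ → E3) (i j k : Fin 3) (x u : E3) (t : ℝ) : ℝ :=
  pd j (pd k (fun y => ρ x y u t i)) x

/-- `Aⁱ(x,u,t)`, the Laplacian of `ρⁱ` in `y` at `y = x`. -/
noncomputable def coeffA (ρ : E3 → E3 → E3 → ℝ → E3) (i : Fin 3) (x u : E3) (t : ℝ) : ℝ :=
  lap (fun y => ρ x y u t i) x

/-- Regularity of a random field with conditional average increment `ρ`. -/
structure IsRegular (ρ : E3 → E3 → E3 → ℝ → E3) : Prop where
  twiceDifferentiable : ∀ x u t, 0 < t → ∀ i : Fin 3, TwiceDifferentiable (fun y => ρ x y u t i)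
  taylor : ∀ x u t, 0 < t → ∀ i : Fin 3,
    (fun y : E3 => ρ x y u t i - ∑ k : Fin 3, coeffB ρ i k x u t * (y k - x k)
        - 1 / 2 * ∑ j : Fin 3, ∑ k : Fin 3,
            coeffA2 ρ i j k x u t * (y j - x j) * (y k - x k))
      =o[𝓝 x] (fun y : E3 => ‖y - x‖ ^ 2)
  differentiable_B : ∀ i k : Fin 3,
    DifferentiableOn ℝ (fun z : E3 × E3 × ℝ => coeffB ρ i k z.1 z.2.1 z.2.2)
      (univ ×ˢ univ ×ˢ Ioi 0)
  differentiable_A : ∀ i j k : Fin 3,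
    DifferentiableOn ℝ (fun z : E3 × E3 × ℝ => coeffA2 ρ i j k z.1 z.2.1 z.2.2)
      (univ ×ˢ univ ×ˢ Ioi 0)

/-- The integrand, as a function of `y`, of the Newtonian potential type integral `Qⁱ(x,u,t)`. -/
noncomputable def integrandQ (ρ : E3 → E3 → E3 → ℝ → E3)
    (σ : E3 → E3 → E3 → ℝ → Fin 3 → Fin 3 → ℝ) (i : Fin 3) (x u : E3) (t : ℝ) (y : E3) : ℝ :=
  (y i - x i) / (4 * Real.pi * ‖y - x‖ ^ 3) *
    ∑ j : Fin 3, ∑ k : Fin 3,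
      pd k (pd j (fun y' => σ x y' u t j k + condMean ρ x y' u t j * condMean ρ x y' u t k)) y

/-- `Qⁱ(x,u,t)`. -/
noncomputable def coeffQ (ρ : E3 → E3 → E3 → ℝ → E3)
    (σ : E3 → E3 → E3 → ℝ → Fin 3 → Fin 3 → ℝ) (i : Fin 3) (x u : E3) (t : ℝ) : ℝ :=
  ∫ y, integrandQ ρ σ i x u t y

/-- `p (u; x, t)` is of class `C^{1,2,1}` in `(u, x, t)` for `t > 0`. -/
structure IsC121 (p : E3 → E3 → ℝ → ℝ) : Prop where
  first : ContDiffOn ℝ 1 (fun z : E3 × E3 × ℝ => p z.1 z.2.1 z.2.2) (univ ×ˢ univ ×ˢ Ioi 0)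
  second : ∀ u t, 0 < t → ContDiff ℝ 2 (fun x => p u x t)
  second_continuous : ∀ j k : Fin 3,
    ContinuousOn (fun z : E3 × E3 × ℝ => pd j (pd k (fun x => p z.1 x z.2.2)) z.2.1)
      (univ ×ˢ univ ×ˢ Ioi 0)

/-- The transport-diffusion part `∂ₜ p + u · ∇ₓ p - ν Δₓ p`. -/
noncomputable def transportPart (ν : ℝ) (p : E3 → E3 → ℝ → ℝ) (u x : E3) (t : ℝ) : ℝ :=
  deriv (fun s => p u x s) t + ∑ i : Fin 3, u i * pd i (fun x' => p u x' t) x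
    - ν * lap (fun x' => p u x' t) x

/-- The flux `ν ∂_{x^k}(p Bⁱ_k) - ν p Aⁱ + p Qⁱ`, whose divergence in `u` is the right side. -/
noncomputable def flux (ν : ℝ) (ρ : E3 → E3 → E3 → ℝ → E3)
    (σ : E3 → E3 → E3 → ℝ → Fin 3 → Fin 3 → ℝ) (p : E3 → E3 → ℝ → ℝ)
    (i : Fin 3) (u x : E3) (t : ℝ) : ℝ :=
  ν * ∑ k : Fin 3, pd k (fun x' => p u x' t * coeffB ρ i k x' u t) x
    - ν * p u x t * coeffA ρ i x u t + p u x t * coeffQ ρ σ i x u t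

end TurbPDF

open MeasureTheory Filter Topology Asymptotics Set

set_option linter.unusedSectionVars false

namespace TurbPDF

/-! ### Calculus of coordinate partial derivatives -/

/-! For a compactly supported test function F, the derivatives of E[F(U(x,t))] = ∫ F(u) p(u;x,t) du
are computed in two ways (repeated indices summed). In time, ∫ F ∂ₜp = E[∂ᵢF(U) ∂ₜUⁱ]. In xᵏ, with
test function F(u)uᵏ, ∫ F uᵏ ∂ₖp = E[F(U) div U] + E[∂ᵢF(U) Uᵏ∂ₖUⁱ], and incompressibility removes
the first term (`hasDerivAt_expectation`, `integral_mul_pd_density`, `integral_transport`). The sum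
pairs ∂ᵢF(U) with the material acceleration, which is νΔUⁱ − ∂ᵢP by the momentum equation.

The forces are then replaced by their conditional expectations given U(x,t). For ΔUⁱ this is Aⁱ,
because versions differentiable in y may be differentiated in y (`IsCondExpGiven.deriv_param`). In
the same way ∫ F ∂ₖp = ∫ ∂ᵢF p Bⁱₖ at every x, and one more x-derivative expresses ∫ F Δₓp through
∂ₖ(pBⁱₖ) (`integral_mul_pd_pd_density`). This accounts for νΔₓp on one side and for the first term
of the flux on the other.

For the pressure, the divergence of the momentum equation gives −ΔP = ∂ⱼ∂ₖ(UʲUᵏ). Since P vanishes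
at infinity, its gradient is the Newtonian integral of this source (`pd_eq_integral_kernel`,
`pd_pressure`). The source is bounded by a multiple of Z²(1+|y|)^(-2α) with 2α > 1, hence integrable
against |y−x|⁻², and Z² has finite mean. Fubini's theorem (`condExp_integral_param`) therefore
carries the conditional expectation inside the integral, where the conditional second moment of U is
σ + b⊗b, and Q appears.

The pointwise equation follows by testing the weak one with bumps shrinking to a point of
differentiability of the flux (`eq_divergence_of_weak`). The initial condition is bounded
convergence along continuous paths. -/

theorem pd_eq_fderiv {k : Fin 3} {f : E3 → ℝ} {x : E3} (h : DifferentiableAt ℝ f x) :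
    pd k f x = fderiv ℝ f x (EuclideanSpace.single k 1) :=
  h.lineDeriv_eq_fderiv

theorem pd_eq_fderiv_fun {k : Fin 3} {f : E3 → ℝ} (h : Differentiable ℝ f) :
    pd k f = fun x => fderiv ℝ f x (EuclideanSpace.single k 1) :=
  funext fun x => pd_eq_fderiv (h x)

theorem hasDerivAt_line {k : Fin 3} {f : E3 → ℝ} {x : E3} {s : ℝ}
    (h : DifferentiableAt ℝ f (x + s • EuclideanSpace.single k 1)) :
    HasDerivAt (fun r : ℝ => f (x + r • EuclideanSpace.single k 1))
      (pd k f (x + s • EuclideanSpace.single k 1)) s := by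
  rw [pd_eq_fderiv h]
  have h2 : HasDerivAt (fun r : ℝ => x + r • (EuclideanSpace.single k 1 : E3))
      (EuclideanSpace.single k 1) s := by
    simpa using ((hasDerivAt_id s).smul_const (EuclideanSpace.single k 1 : E3)).const_add x
  exact h.hasFDerivAt.comp_hasDerivAt s h2

theorem pd_eq_of_hasDerivAt {k : Fin 3} {f : E3 → ℝ} {x : E3} {c : ℝ}
    (h : HasDerivAt (fun r : ℝ => f (x + r • EuclideanSpace.single k 1)) c 0) :
    pd k f x = c := HasDerivAt.deriv h

theorem pd_add {k : Fin 3} {f g : E3 → ℝ} {x : E3} (hf : DifferentiableAt ℝ f x)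
    (hg : DifferentiableAt ℝ g x) : pd k (fun y => f y + g y) x = pd k f x + pd k g x := by
  rw [pd_eq_fderiv (hf.fun_add hg), pd_eq_fderiv hf, pd_eq_fderiv hg, fderiv_fun_add hf hg]; rfl

theorem pd_sub {k : Fin 3} {f g : E3 → ℝ} {x : E3} (hf : DifferentiableAt ℝ f x)
    (hg : DifferentiableAt ℝ g x) : pd k (fun y => f y - g y) x = pd k f x - pd k g x := by
  rw [pd_eq_fderiv (hf.fun_sub hg), pd_eq_fderiv hf, pd_eq_fderiv hg, fderiv_fun_sub hf hg]; rfl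

theorem pd_sub_const {k : Fin 3} {f : E3 → ℝ} {x : E3} (c : ℝ) :
    pd k (fun y => f y - c) x = pd k f x := by
  simp [pd, lineDeriv]

theorem pd_const_mul {k : Fin 3} {f : E3 → ℝ} {x : E3} (c : ℝ) (hf : DifferentiableAt ℝ f x) :
    pd k (fun y => c * f y) x = c * pd k f x := by
  rw [pd_eq_fderiv (hf.const_mul c), pd_eq_fderiv hf, fderiv_const_mul hf]; rfl

theorem pd_mul {k : Fin 3} {f g : E3 → ℝ} {x : E3} (hf : DifferentiableAt ℝ f x)
    (hg : DifferentiableAt ℝ g x) :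
    pd k (fun y => f y * g y) x = f x * pd k g x + pd k f x * g x := by
  rw [pd_eq_fderiv (hf.fun_mul hg), pd_eq_fderiv hf, pd_eq_fderiv hg, fderiv_fun_mul hf hg]
  simp [mul_comm]

theorem pd_sum {ι : Type*} {s : Finset ι} {k : Fin 3} {f : ι → E3 → ℝ} {x : E3}
    (hf : ∀ i ∈ s, DifferentiableAt ℝ (f i) x) :
    pd k (fun y => ∑ i ∈ s, f i y) x = ∑ i ∈ s, pd k (f i) x := by
  rw [pd_eq_fderiv (DifferentiableAt.fun_sum hf), fderiv_fun_sum hf,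
    _root_.sum_apply]
  exact Finset.sum_congr rfl fun i hi => (pd_eq_fderiv (hf i hi)).symm

theorem pd_zero (k : Fin 3) (x : E3) : pd k (fun _ => (0 : ℝ)) x = 0 := by
  simp [pd, lineDeriv]

theorem contDiff_pd {n : ℕ} {k : Fin 3} {f : E3 → ℝ} (hf : ContDiff ℝ (n + 1 : ℕ) f) :
    ContDiff ℝ n (pd k f) := by
  rw [pd_eq_fderiv_fun (hf.differentiable (by simp))]
  exact (hf.fderiv_right (m := n) (by norm_cast)).clm_apply contDiff_const

theorem continuous_pd {k : Fin 3} {f : E3 → ℝ} (hf : ContDiff ℝ 1 f) : Continuous (pd k f) :=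
  (contDiff_pd (n := 0) (by simpa using hf)).continuous

theorem hasCompactSupport_pd {k : Fin 3} {f : E3 → ℝ} (hf : HasCompactSupport f)
    (h : Differentiable ℝ f) : HasCompactSupport (pd k f) := by
  rw [pd_eq_fderiv_fun h]
  exact hf.fderiv_apply (𝕜 := ℝ) _

theorem pd_comm {j k : Fin 3} {f : E3 → ℝ} (hf : ContDiff ℝ 2 f) (x : E3) :
    pd j (pd k f) x = pd k (pd j f) x := by
  have hd : Differentiable ℝ f := hf.differentiable (by simp)
  have hd2 : Differentiable ℝ (fderiv ℝ f) :=
    (hf.fderiv_right (m := 1) (by norm_num)).differentiable (by simp)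
  have key : ∀ i l : Fin 3, pd i (pd l f) x
      = fderiv ℝ (fderiv ℝ f) x (EuclideanSpace.single i 1) (EuclideanSpace.single l 1) := by
    intro i l
    rw [pd_eq_fderiv_fun hd,
      pd_eq_fderiv ((hd2 x).clm_apply (differentiableAt_const _)),
      fderiv_clm_apply (hd2 x) (differentiableAt_const _)]
    simp
  rw [key, key]
  exact (hf.contDiffAt.isSymmSndFDerivAt (by simp)).eq _ _

theorem TwiceDifferentiable.differentiable_pd {f : E3 → ℝ} (hf : TwiceDifferentiable f)
    (k : Fin 3) : Differentiable ℝ (pd k f) := by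
  rw [pd_eq_fderiv_fun hf.1]
  exact hf.2.clm_apply (differentiable_const _)

theorem twiceDifferentiable_of_contDiff {f : E3 → ℝ} (hf : ContDiff ℝ 2 f) :
    TwiceDifferentiable f :=
  ⟨hf.differentiable (by simp),
    (hf.fderiv_right (m := 1) (by norm_num)).differentiable (by simp)⟩

theorem TwiceDifferentiable.add {f g : E3 → ℝ} (hf : TwiceDifferentiable f)
    (hg : TwiceDifferentiable g) : TwiceDifferentiable (fun y => f y + g y) := by
  refine ⟨hf.1.fun_add hg.1, ?_⟩
  have : fderiv ℝ (fun y => f y + g y) = fun y => fderiv ℝ f y + fderiv ℝ g y :=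
    funext fun y => fderiv_fun_add (hf.1 y) (hg.1 y)
  rw [this]
  exact hf.2.fun_add hg.2

theorem TwiceDifferentiable.mul {f g : E3 → ℝ} (hf : TwiceDifferentiable f)
    (hg : TwiceDifferentiable g) : TwiceDifferentiable (fun y => f y * g y) := by
  refine ⟨hf.1.fun_mul hg.1, ?_⟩
  have : fderiv ℝ (fun y => f y * g y) = fun y => f y • fderiv ℝ g y + g y • fderiv ℝ f y :=
    funext fun y => fderiv_fun_mul (hf.1 y) (hg.1 y)
  rw [this]
  exact (hf.1.fun_smul hg.2).fun_add (hg.1.fun_smul hf.2)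

theorem TwiceDifferentiable.add_const {f : E3 → ℝ} (hf : TwiceDifferentiable f) (c : ℝ) :
    TwiceDifferentiable (fun y => f y + c) :=
  hf.add (twiceDifferentiable_of_contDiff contDiff_const)

theorem single_sum (v : E3) : v = ∑ i : Fin 3, v i • (EuclideanSpace.single i 1 : E3) := by
  ext j
  simp [EuclideanSpace.single, Pi.single_apply]

theorem fderiv_eq_sum_pd {f : E3 → ℝ} {x : E3} (hf : DifferentiableAt ℝ f x) (v : E3) :
    fderiv ℝ f x v = ∑ i : Fin 3, v i * pd i f x := by
  conv_lhs => rw [single_sum v]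
  simp [map_sum, pd_eq_fderiv hf]

theorem hasDerivAt_coord {γ : ℝ → E3} {γ' : Fin 3 → ℝ} {s : ℝ}
    (h : ∀ i, HasDerivAt (fun r => γ r i) (γ' i) s) :
    HasDerivAt γ (WithLp.toLp 2 γ') s := by
  rw [hasDerivAt_iff_hasFDerivAt, ← hasFDerivWithinAt_univ, hasFDerivWithinAt_euclidean]
  intro i
  rw [hasFDerivWithinAt_univ]
  have := (h i).hasFDerivAt
  convert! this using 1

/-- Chain rule for a function of three variables along a curve. -/
theorem hasDerivAt_comp_curve {f : E3 → ℝ} {γ : ℝ → E3} {γ' : Fin 3 → ℝ} {s : ℝ}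
    (hf : DifferentiableAt ℝ f (γ s)) (h : ∀ i, HasDerivAt (fun r => γ r i) (γ' i) s) :
    HasDerivAt (fun r => f (γ r)) (∑ i : Fin 3, pd i f (γ s) * γ' i) s := by
  have := hf.hasFDerivAt.comp_hasDerivAt s (hasDerivAt_coord h)
  rw [fderiv_eq_sum_pd hf] at this
  simp only [mul_comm] at this ⊢
  exact this

theorem abs_sub_le_of_pd_bound {k : Fin 3} {f : E3 → ℝ} {W : ℝ} (hf : Differentiable ℝ f)
    (hW : ∀ y, |pd k f y| ≤ W) (x : E3) (h : ℝ) :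
    |f (x + h • EuclideanSpace.single k 1) - f x| ≤ W * |h| := by
  have := Convex.norm_image_sub_le_of_norm_hasDerivWithin_le (s := univ) (x := (0 : ℝ)) (y := h)
    (f := fun r : ℝ => f (x + r • EuclideanSpace.single k 1)) (C := W)
    (fun r _ => (hasDerivAt_line (hf _)).hasDerivWithinAt) (fun r _ => hW _) convex_univ
    (mem_univ _) (mem_univ _)
  simpa using this

/-- The difference quotient of step `1 / (n + 1)` in the `k`-th coordinate direction. -/
noncomputable def dq (k : Fin 3) (n : ℕ) (f : E3 → ℝ) (x : E3) : ℝ :=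
  ((n : ℝ) + 1) * (f (x + (1 / ((n : ℝ) + 1)) • EuclideanSpace.single k 1) - f x)

theorem tendsto_dq {k : Fin 3} {f : E3 → ℝ} {x : E3} (hf : DifferentiableAt ℝ f x) :
    Tendsto (fun n => dq k n f x) atTop (𝓝 (pd k f x)) := by
  have h := hasDerivAt_line (k := k) (f := f) (x := x) (s := 0) (by simpa using hf)
  rw [hasDerivAt_iff_tendsto_slope_zero] at h
  have h0 : Tendsto (fun n : ℕ => 1 / ((n : ℝ) + 1)) atTop (𝓝[≠] 0) :=
    tendsto_nhdsWithin_iff.2 ⟨tendsto_one_div_add_atTop_nhds_zero_nat,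
      Eventually.of_forall fun n => by simp; positivity⟩
  have := h.comp h0
  simp only [zero_smul, add_zero, zero_add] at this
  refine this.congr fun n => ?_
  simp [dq]

theorem abs_dq_le {k : Fin 3} {f : E3 → ℝ} {W : ℝ} (hf : Differentiable ℝ f)
    (hW : ∀ y, |pd k f y| ≤ W) (n : ℕ) (x : E3) : |dq k n f x| ≤ W := by
  have h := abs_sub_le_of_pd_bound hf hW x (1 / ((n : ℝ) + 1))
  have hn : (0 : ℝ) < (n : ℝ) + 1 := by positivity
  rw [dq, abs_mul, abs_of_pos hn]
  calc _ ≤ ((n : ℝ) + 1) * (W * |1 / ((n : ℝ) + 1)|) := by gcongr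
    _ = W := by rw [abs_of_pos (by positivity)]; field_simp

/-- The derivative is the limit of the quotients `dq`, each of them measurable in the parameter.
Using one fixed sequence of steps keeps every exceptional set countable when the same quotients are
used for conditional expectations. -/
theorem measurable_pd {α : Type*} [MeasurableSpace α] {k : Fin 3} {f : E3 → α → ℝ} {x : E3}
    (hf : ∀ y, Measurable (f y)) (hd : ∀ a, DifferentiableAt ℝ (fun y => f y a) x) :
    Measurable (fun a => pd k (fun y => f y a) x) := by
  refine measurable_of_tendsto_metrizable (f := fun n a => dq k n (fun y => f y a) x)
    (fun n => ?_) (tendsto_pi_nhds.2 fun a => tendsto_dq (hd a))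
  exact ((hf _).sub (hf _)).const_mul _

end TurbPDF

namespace TurbPDF

/-! ### Representation of the gradient of a decaying Newtonian potential -/

theorem integral_mul_pd {k : Fin 3} {f g : E3 → ℝ} (hf : ContDiff ℝ 1 f) (hg : ContDiff ℝ 1 g)
    (hc : HasCompactSupport f) : ∫ x, f x * pd k g x = - ∫ x, pd k f x * g x := by
  have hfd := hf.differentiable (by simp)
  have hgd := hg.differentiable (by simp)
  have h1 : Integrable (fun x => pd k f x * g x) :=
    ((continuous_pd hf).mul hg.continuous).integrable_of_hasCompactSupport
      ((hasCompactSupport_pd hc hfd).mul_right)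
  have h2 : Integrable (fun x => f x * pd k g x) :=
    (hf.continuous.mul (continuous_pd hg)).integrable_of_hasCompactSupport hc.mul_right
  have h3 : Integrable (fun x => f x * g x) :=
    (hf.continuous.mul hg.continuous).integrable_of_hasCompactSupport hc.mul_right
  simp only [pd_eq_fderiv_fun hfd, pd_eq_fderiv_fun hgd] at h1 h2 ⊢
  exact integral_mul_fderiv_eq_neg_fderiv_mul_of_integrable h1 h2 h3 (fun x _ => hfd x)
    (fun x _ => hgd x)

theorem differentiable_coord (i : Fin 3) : Differentiable ℝ (fun y : E3 => y i) :=
  (EuclideanSpace.proj (𝕜 := ℝ) i).differentiable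

theorem contDiff_coord {n : WithTop ℕ∞} (i : Fin 3) : ContDiff ℝ n (fun y : E3 => y i) :=
  (EuclideanSpace.proj (𝕜 := ℝ) i).contDiff

theorem pd_coord (i j : Fin 3) (y : E3) :
    pd j (fun y : E3 => y i) y = if i = j then 1 else 0 := by
  rw [pd_eq_fderiv (differentiable_coord i y)]
  have : fderiv ℝ (fun y : E3 => y i) y = EuclideanSpace.proj (𝕜 := ℝ) i :=
    (EuclideanSpace.proj (𝕜 := ℝ) i).fderiv
  rw [this]
  simp

theorem abs_coord_le_norm (y : E3) (i : Fin 3) : |y i| ≤ ‖y‖ := by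
  simpa using PiLp.norm_apply_le y i

theorem contDiff_radial {n : WithTop ℕ∞} {w : ℝ → ℝ} (hw : ContDiff ℝ n w) :
    ContDiff ℝ n (fun y : E3 => w (‖y‖ ^ 2)) :=
  hw.comp (contDiff_norm_sq ℝ)

theorem pd_radial {w : ℝ → ℝ} {y : E3} (hw : DifferentiableAt ℝ w (‖y‖ ^ 2)) (j : Fin 3) :
    pd j (fun y : E3 => w (‖y‖ ^ 2)) y = 2 * y j * deriv w (‖y‖ ^ 2) := by
  apply pd_eq_of_hasDerivAt
  have h1 : HasDerivAt (fun r : ℝ => y + r • (EuclideanSpace.single j 1 : E3))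
      (EuclideanSpace.single j 1) 0 := by
    simpa using ((hasDerivAt_id (0 : ℝ)).smul_const (EuclideanSpace.single j 1 : E3)).const_add y
  have h2 := h1.norm_sq
  have h3 : HasDerivAt w (deriv w (‖y‖ ^ 2))
      (‖y + (0 : ℝ) • (EuclideanSpace.single j 1 : E3)‖ ^ 2) := by
    simpa using hw.hasDerivAt
  have := h3.comp 0 h2
  convert! this using 1
  simp [EuclideanSpace.inner_single_right]
  ring

theorem pd_coord_mul_radial {w : ℝ → ℝ} (hw : Differentiable ℝ w) (i j : Fin 3) (y : E3) :
    pd j (fun y : E3 => y i * w (‖y‖ ^ 2)) y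
      = 2 * y i * y j * deriv w (‖y‖ ^ 2) + (if i = j then 1 else 0) * w (‖y‖ ^ 2) := by
  have h : DifferentiableAt ℝ (fun y : E3 => w (‖y‖ ^ 2)) y :=
    (hw _).comp y ((contDiff_norm_sq ℝ (n := 1)).differentiable (by simp) y)
  rw [pd_mul (differentiable_coord i y) h, pd_radial (hw _), pd_coord]
  ring

theorem hasCompactSupport_radial {w : ℝ → ℝ} {R : ℝ} (hR : ∀ s, R ≤ s → w s = 0) :
    HasCompactSupport (fun y : E3 => w (‖y‖ ^ 2)) := by
  refine HasCompactSupport.intro (isCompact_closedBall (0 : E3) (max R 1)) fun y hy => ?_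
  apply hR
  have h1 : max R 1 < ‖y‖ := by simpa using hy
  have : 1 ≤ ‖y‖ := (le_max_right R 1).trans h1.le
  calc R ≤ ‖y‖ := (le_max_left R 1).trans h1.le
    _ ≤ ‖y‖ ^ 2 := by nlinarith

/-- The divergence of `y ↦ w (|y|²) y` is `radialDiv w (|y|²)`. -/
noncomputable def radialDiv (w : ℝ → ℝ) (s : ℝ) : ℝ := 3 * w s + 2 * s * deriv w s

/-- The radial field K(y) = w(|y|²)y is curl free, so ∂ⱼKᵢ = ∂ᵢKⱼ. Integrating by parts, exchanging
the indices and integrating back turns Kᵢ ∂ⱼ∂ⱼP into Kⱼ ∂ⱼ∂ᵢP. A last integration by parts produces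
the divergence of K. -/
theorem integral_coord_radial_mul_lap {w : ℝ → ℝ} (hw : ContDiff ℝ 1 w) {R : ℝ}
    (hR : ∀ s, R ≤ s → w s = 0) {P : E3 → ℝ} (hP : ContDiff ℝ 2 P) (i : Fin 3) :
    ∫ y : E3, y i * w (‖y‖ ^ 2) * lap P y
      = - ∫ y : E3, radialDiv w (‖y‖ ^ 2) * pd i P y := by
  have hwd := hw.differentiable (by simp)
  have hK : ∀ i : Fin 3, ContDiff ℝ 1 (fun y : E3 => y i * w (‖y‖ ^ 2)) := fun i =>
    (contDiff_coord i).mul (contDiff_radial hw)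
  have hKc : ∀ i : Fin 3, HasCompactSupport (fun y : E3 => y i * w (‖y‖ ^ 2)) := fun i =>
    (hasCompactSupport_radial hR).mul_left
  have hP1 : ∀ j, ContDiff ℝ 1 (pd j P) := fun j => contDiff_pd (n := 1) (by simpa using hP)
  have hint : ∀ {f g : E3 → ℝ}, Continuous f → HasCompactSupport f → Continuous g →
      Integrable (fun y => f y * g y) := fun hf hfc hg =>
    (hf.mul hg).integrable_of_hasCompactSupport hfc.mul_right
  have hpc : ∀ i j : Fin 3, HasCompactSupport (pd j (fun y : E3 => y i * w (‖y‖ ^ 2))) :=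
    fun i j => hasCompactSupport_pd (hKc i) ((hK i).differentiable (by simp))
  have step : ∀ j : Fin 3, ∫ y : E3, y i * w (‖y‖ ^ 2) * pd j (pd j P) y
      = - ∫ y : E3, pd j (fun y : E3 => y j * w (‖y‖ ^ 2)) y * pd i P y := by
    intro j
    calc ∫ y : E3, y i * w (‖y‖ ^ 2) * pd j (pd j P) y
        = - ∫ y : E3, pd j (fun y : E3 => y i * w (‖y‖ ^ 2)) y * pd j P y :=
          integral_mul_pd (hK i) (hP1 j) (hKc i)
      _ = - ∫ y : E3, pd i (fun y : E3 => y j * w (‖y‖ ^ 2)) y * pd j P y := by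
          congr 2; ext y
          rw [pd_coord_mul_radial hwd, pd_coord_mul_radial hwd]
          simp only [eq_comm (a := i)]; ring
      _ = ∫ y : E3, y j * w (‖y‖ ^ 2) * pd i (pd j P) y :=
          (integral_mul_pd (hK j) (hP1 j) (hKc j)).symm
      _ = ∫ y : E3, y j * w (‖y‖ ^ 2) * pd j (pd i P) y := by
          congr 1; ext y; rw [pd_comm hP]
      _ = _ := integral_mul_pd (hK j) (hP1 i) (hKc j)
  have e1 : ∫ y : E3, y i * w (‖y‖ ^ 2) * lap P y
      = ∑ j : Fin 3, ∫ y : E3, y i * w (‖y‖ ^ 2) * pd j (pd j P) y := by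
    rw [← integral_finsetSum]
    · simp only [lap, Finset.mul_sum]
    · exact fun j _ => hint (hK i).continuous (hKc i) (continuous_pd (hP1 j))
  rw [e1]
  simp only [step, Finset.sum_neg_distrib]
  congr 1
  rw [← integral_finsetSum]
  · congr 1; ext y
    rw [← Finset.sum_mul]
    congr 1
    have e : ‖y‖ ^ 2 = y 0 ^ 2 + y 1 ^ 2 + y 2 ^ 2 := by
      simp [EuclideanSpace.norm_sq_eq, Fin.sum_univ_three]
    simp only [pd_coord_mul_radial hwd, radialDiv, Fin.sum_univ_three, if_true, one_mul]
    rw [mul_assoc 2 (‖y‖ ^ 2), show ∀ d, ‖y‖ ^ 2 * d = (y 0 ^ 2 + y 1 ^ 2 + y 2 ^ 2) * d by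
      intro d; rw [e]]
    ring
  · exact fun j _ => hint (continuous_pd (hK j)) (hpc j j) (hP1 i).continuous

/-! #### A cut-off of the Newtonian kernel -/

/-- A smooth function vanishing for `s ≤ 1/2` and equal to one for `1 ≤ s`. -/
noncomputable def cutoff (s : ℝ) : ℝ := Real.smoothTransition (2 * s - 1)

theorem contDiff_cutoff : ContDiff ℝ (⊤ : ℕ∞) cutoff :=
  Real.smoothTransition.contDiff.comp (by fun_prop)

theorem cutoff_nonneg (s : ℝ) : 0 ≤ cutoff s := Real.smoothTransition.nonneg _

theorem cutoff_le_one (s : ℝ) : cutoff s ≤ 1 := Real.smoothTransition.le_one _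

theorem cutoff_of_le {s : ℝ} (h : s ≤ 1 / 2) : cutoff s = 0 :=
  Real.smoothTransition.zero_of_nonpos (by linarith)

theorem cutoff_of_ge {s : ℝ} (h : 1 ≤ s) : cutoff s = 1 :=
  Real.smoothTransition.one_of_one_le (by linarith)

/-- The profile, as a function of `s = |y|²`, of a cut-off of the kernel `y / (4π|y|³)`. -/
noncomputable def cutProfile (s : ℝ) : ℝ := cutoff s * (s ^ (-(3 / 2) : ℝ) / (4 * Real.pi))

theorem contDiff_cutProfile : ContDiff ℝ (⊤ : ℕ∞) cutProfile := by
  rw [contDiff_iff_contDiffAt]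
  intro s
  rcases lt_or_ge s (1 / 2) with h | h
  · have : cutProfile =ᶠ[𝓝 s] fun _ => 0 := by
      filter_upwards [Iio_mem_nhds h] with r hr
      rw [cutProfile, cutoff_of_le (le_of_lt hr), zero_mul]
    exact contDiffAt_const.congr_of_eventuallyEq this
  · have hs : s ≠ 0 := by linarith
    exact contDiff_cutoff.contDiffAt.mul
      ((Real.contDiffAt_rpow_const_of_ne hs).div_const _)

theorem contDiff_radialDiv {w : ℝ → ℝ} (hw : ContDiff ℝ (⊤ : ℕ∞) w) :
    ContDiff ℝ (⊤ : ℕ∞) (radialDiv w) := by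
  have := (contDiff_infty_iff_deriv.1 hw).2
  exact (contDiff_const.mul hw).add ((contDiff_const.mul contDiff_id).mul this)

theorem cutProfile_nonneg (s : ℝ) (hs : 0 ≤ s) : 0 ≤ cutProfile s :=
  mul_nonneg (cutoff_nonneg s) (by positivity)

theorem cutProfile_le (s : ℝ) (hs : 0 ≤ s) : cutProfile s ≤ s ^ (-(3 / 2) : ℝ) / (4 * Real.pi) :=
  mul_le_of_le_one_left (by positivity) (cutoff_le_one s)

theorem cutProfile_of_ge {s : ℝ} (h : 1 ≤ s) :
    cutProfile s = s ^ (-(3 / 2) : ℝ) / (4 * Real.pi) := by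
  rw [cutProfile, cutoff_of_ge h, one_mul]

theorem cutProfile_of_le {s : ℝ} (h : s ≤ 1 / 2) : cutProfile s = 0 := by
  rw [cutProfile, cutoff_of_le h, zero_mul]

/-- The Newtonian kernel is divergence free away from the origin: 3w + 2sw′ = 0 for w = s^(-3/2).
Only the derivative falling on the cut-off survives. -/
theorem radialDiv_cutProfile {s : ℝ} (hs : 0 < s) :
    radialDiv cutProfile s = s ^ (-(1 / 2) : ℝ) * deriv cutoff s / (2 * Real.pi) := by
  have h1 : HasDerivAt (fun r : ℝ => r ^ (-(3 / 2) : ℝ) / (4 * Real.pi))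
      (-(3 / 2) * s ^ (-(3 / 2) - 1 : ℝ) / (4 * Real.pi)) s :=
    (Real.hasDerivAt_rpow_const (Or.inl hs.ne')).div_const _
  have h2 : HasDerivAt cutoff (deriv cutoff s) s :=
    (contDiff_cutoff.differentiable (by simp) s).hasDerivAt
  have h3 : deriv cutProfile s = _ := (h2.mul h1).deriv
  have e1 : s ^ (-(3 / 2) - 1 : ℝ) = s ^ (-(1 / 2) : ℝ) / s / s := by
    rw [← Real.rpow_sub_one hs.ne', ← Real.rpow_sub_one hs.ne']; norm_num
  have e2 : s ^ (-(3 / 2) : ℝ) = s ^ (-(1 / 2) : ℝ) / s := by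
    rw [← Real.rpow_sub_one hs.ne']; norm_num
  rw [radialDiv, h3, cutProfile, e1, e2]
  field_simp
  ring

theorem deriv_cutoff_of_gt {s : ℝ} (h : 1 < s) : deriv cutoff s = 0 := by
  have : cutoff =ᶠ[𝓝 s] fun _ => 1 := by
    filter_upwards [Ioi_mem_nhds h] with r hr using cutoff_of_ge (le_of_lt hr)
  rw [this.deriv_eq, deriv_const]

theorem radialDiv_cutProfile_of_ge {s : ℝ} (h : 2 ≤ s) : radialDiv cutProfile s = 0 := by
  rw [radialDiv_cutProfile (by linarith), deriv_cutoff_of_gt (by linarith)]; simp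

theorem continuous_radialDiv_cutProfile :
    Continuous (fun y : E3 => radialDiv cutProfile (‖y‖ ^ 2)) :=
  (contDiff_radial (n := (⊤ : ℕ∞)) (contDiff_radialDiv contDiff_cutProfile)).continuous

/-- This is the flux of the kernel through a large sphere. In polar coordinates the integrand, with
its Jacobian r², is the derivative of `cutoff (r ^ 2) / (4 * π)`, which increases from 0 to 1/(4π);
the sphere has area 4π. -/
theorem integral_radialDiv_cutProfile :
    ∫ y : E3, radialDiv cutProfile (‖y‖ ^ 2) = 1 := by
  have h := integral_fun_norm_addHaar (volume : Measure E3)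
    (fun r : ℝ => radialDiv cutProfile (r ^ 2))
  rw [h]
  have hv : (volume : Measure E3).real (Metric.ball 0 1) = Real.pi * 4 / 3 := by
    rw [Measure.real, EuclideanSpace.volume_ball_fin_three]
    simp; positivity
  rw [hv]
  have hd : ∀ r ∈ Ioi (0 : ℝ), HasDerivAt (fun r => cutoff (r ^ 2) / (4 * Real.pi))
      (r ^ (Module.finrank ℝ E3 - 1) • radialDiv cutProfile (r ^ 2)) r := by
    intro r hr
    have hr0 : (0 : ℝ) < r := hr
    have h1 : HasDerivAt cutoff (deriv cutoff (r ^ 2)) (r ^ 2) :=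
      (contDiff_cutoff.differentiable (by simp) _).hasDerivAt
    have h2 := (HasDerivAt.comp (h₂ := cutoff) (h := fun r : ℝ => r ^ 2) r h1
      (by simpa using hasDerivAt_pow 2 r)).div_const (4 * Real.pi)
    convert! h2 using 1
    have e : (r ^ 2) ^ (-(1 / 2) : ℝ) = r⁻¹ := by
      rw [← Real.rpow_natCast, ← Real.rpow_mul hr0.le]
      norm_num [Real.rpow_neg_one]
    rw [radialDiv_cutProfile (by positivity), e]
    simp
    field_simp
    ring
  have hlim : Tendsto (fun r : ℝ => cutoff (r ^ 2) / (4 * Real.pi)) atTop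
      (𝓝 (1 / (4 * Real.pi))) := by
    refine tendsto_const_nhds.congr' ?_
    filter_upwards [eventually_ge_atTop (1 : ℝ)] with r hr
    rw [cutoff_of_ge (by nlinarith)]
  have hint : IntegrableOn (fun r : ℝ => r ^ (Module.finrank ℝ E3 - 1) •
      radialDiv cutProfile (r ^ 2)) (Ioi 0) := by
    rw [← integrable_fun_norm_addHaar (volume : Measure E3)
      (f := fun r : ℝ => radialDiv cutProfile (r ^ 2))]
    exact continuous_radialDiv_cutProfile.integrable_of_hasCompactSupport
      (hasCompactSupport_radial (R := 2) fun s hs => radialDiv_cutProfile_of_ge hs)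
  rw [integral_Ioi_of_hasDerivAt_of_tendsto (m := 1 / (4 * Real.pi)) (by
      have : Continuous (fun r : ℝ => cutoff (r ^ 2) / (4 * Real.pi)) :=
        (contDiff_cutoff.continuous.comp (continuous_pow 2)).div_const _
      exact this.continuousWithinAt) hd hint hlim]
  rw [cutoff_of_le (by norm_num)]
  simp
  field_simp

end TurbPDF

/-! ### Two-scale truncation of the kernel and Green's representation -/

namespace TurbPDF

/-- The kernel profile cut off at the length scale `1 / a`. -/
noncomputable def scaledProfile (a s : ℝ) : ℝ := a ^ 3 * cutProfile (a ^ 2 * s)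

theorem contDiff_scaledProfile (a : ℝ) : ContDiff ℝ (⊤ : ℕ∞) (scaledProfile a) :=
  contDiff_const.mul (contDiff_cutProfile.comp (contDiff_const.mul contDiff_id))

/-- Homogeneity of the kernel: rescaling moves the cut-off but leaves the kernel itself unchanged.
-/
theorem rpow_scaling {a s : ℝ} (ha : 0 < a) (hs : 0 ≤ s) :
    a ^ 3 * (a ^ 2 * s) ^ (-(3 / 2) : ℝ) = s ^ (-(3 / 2) : ℝ) := by
  rw [Real.mul_rpow (by positivity) hs, ← mul_assoc, ← Real.rpow_natCast a 2,
    ← Real.rpow_mul ha.le, ← Real.rpow_natCast a 3, ← Real.rpow_add ha]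
  norm_num

theorem scaledProfile_of_ge {a s : ℝ} (ha : 0 < a) (hs : 0 ≤ s) (h : 1 ≤ a ^ 2 * s) :
    scaledProfile a s = s ^ (-(3 / 2) : ℝ) / (4 * Real.pi) := by
  rw [scaledProfile, cutProfile_of_ge h, ← mul_div_assoc, rpow_scaling ha hs]

theorem scaledProfile_of_le {a s : ℝ} (h : a ^ 2 * s ≤ 1 / 2) : scaledProfile a s = 0 := by
  rw [scaledProfile, cutProfile_of_le h, mul_zero]

theorem scaledProfile_nonneg {a s : ℝ} (ha : 0 < a) (hs : 0 ≤ s) : 0 ≤ scaledProfile a s :=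
  mul_nonneg (by positivity) (cutProfile_nonneg _ (by positivity))

theorem scaledProfile_le {a s : ℝ} (ha : 0 < a) (hs : 0 ≤ s) :
    scaledProfile a s ≤ s ^ (-(3 / 2) : ℝ) / (4 * Real.pi) := by
  rw [← rpow_scaling ha hs, mul_div_assoc]
  exact mul_le_mul_of_nonneg_left (cutProfile_le _ (by positivity)) (by positivity)

/-- The divergences at all scales are mass-preserving dilates of a single bump: an approximate
identity as a → ∞, and a spreading average as a → 0. -/
theorem radialDiv_scaledProfile (a s : ℝ) :
    radialDiv (scaledProfile a) s = a ^ 3 * radialDiv cutProfile (a ^ 2 * s) := by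
  have h1 : HasDerivAt (scaledProfile a) (a ^ 3 * (deriv cutProfile (a ^ 2 * s) * a ^ 2)) s := by
    have h2 : HasDerivAt (fun s => a ^ 2 * s) (a ^ 2) s := by
      simpa using (hasDerivAt_id s).const_mul (a ^ 2)
    exact ((contDiff_cutProfile.differentiable (by simp) (a ^ 2 * s)).hasDerivAt.comp s
      h2).const_mul (a ^ 3)
  rw [radialDiv, h1.deriv, scaledProfile, radialDiv]
  ring

theorem norm_sq_rpow (y : E3) : (‖y‖ ^ 2) ^ (-(3 / 2) : ℝ) = (‖y‖ ^ 3)⁻¹ := by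
  rw [← Real.rpow_natCast, ← Real.rpow_mul (norm_nonneg _), ← Real.rpow_natCast ‖y‖ 3,
    ← Real.rpow_neg (norm_nonneg _)]
  norm_num

theorem pd_comp_smul {P : E3 → ℝ} (hP : Differentiable ℝ P) (b : ℝ) (i : Fin 3) (z : E3) :
    pd i (fun z => P (b • z)) z = b * pd i P (b • z) := by
  apply pd_eq_of_hasDerivAt
  have h := hasDerivAt_line (k := i) (f := P) (x := b • z) (s := b * 0) (hP _)
  have h2 : HasDerivAt (fun r : ℝ => b * r) b 0 := by
    simpa using (hasDerivAt_id (0 : ℝ)).const_mul b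
  have := HasDerivAt.comp (h := fun r : ℝ => b * r) 0 h h2
  convert! this using 1
  · ext r; simp [smul_smul]
  · simp [mul_comm]

theorem integral_scaled_mul {D g : E3 → ℝ} {a : ℝ} (ha : 0 < a) :
    ∫ y, a ^ 3 * D (a • y) * g y = ∫ z, D z * g (a⁻¹ • z) := by
  have h := Measure.integral_comp_smul (volume : Measure E3) (fun z => D z * g (a⁻¹ • z)) a
  simp only [smul_smul, inv_mul_cancel₀ ha.ne', one_smul] at h
  simp only [mul_assoc, integral_const_mul]
  rw [h]
  have : |(a ^ Module.finrank ℝ E3)⁻¹| = (a ^ 3)⁻¹ := by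
    rw [abs_of_pos (by positivity)]; simp
  rw [this, smul_eq_mul, ← mul_assoc, mul_inv_cancel₀ (by positivity), one_mul]

theorem exists_bound_of_tendsto_zero {P : E3 → ℝ} (hP : Continuous P)
    (h0 : Tendsto P (cocompact E3) (𝓝 0)) : ∃ M, ∀ y, |P y| ≤ M := by
  have h1 : ∀ᶠ y in cocompact E3, |P y| < 1 := by
    have := h0.abs
    rw [abs_zero] at this
    exact this.eventually_lt_const one_pos
  obtain ⟨K, hK, hKs⟩ := mem_cocompact.1 h1
  obtain ⟨M, hM⟩ := hK.exists_bound_of_continuousOn hP.continuousOn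
  refine ⟨max M 1, fun y => ?_⟩
  by_cases hy : y ∈ K
  · exact (hM y hy).trans (le_max_left _ _)
  · exact (le_of_lt (hKs hy)).trans (le_max_right _ _)

theorem tendsto_mollified {D g : E3 → ℝ} (hD : Continuous D) (hDc : HasCompactSupport D)
    (hg : Continuous g) {b : ℕ → ℝ} (hb : Tendsto b atTop (𝓝 0)) (hb1 : ∀ n, |b n| ≤ 1) :
    Tendsto (fun n => ∫ z, D z * g (b n • z)) atTop (𝓝 ((∫ z, D z) * g 0)) := by
  obtain ⟨R, hR⟩ := hDc.isCompact.isBounded.subset_closedBall (0 : E3)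
  obtain ⟨M, hM⟩ := (isCompact_closedBall (0 : E3) R).exists_bound_of_continuousOn hg.continuousOn
  rw [← integral_mul_const]
  refine tendsto_integral_of_dominated_convergence (fun z => |D z| * M) (fun n => ?_)
    ((hD.integrable_of_hasCompactSupport hDc).abs.mul_const _) (fun n => ?_) ?_
  · exact (hD.mul (hg.comp (continuous_const_smul _))).aestronglyMeasurable
  · refine Eventually.of_forall fun z => ?_
    by_cases hz : z ∈ tsupport D
    · have h1 : ‖z‖ ≤ R := by simpa using hR hz
      have h2 : b n • z ∈ Metric.closedBall (0 : E3) R := by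
        simp only [mem_closedBall_zero_iff, norm_smul, Real.norm_eq_abs]
        exact (mul_le_of_le_one_left (norm_nonneg _) (hb1 n)).trans h1
      rw [norm_mul]
      exact mul_le_mul_of_nonneg_left (hM _ h2) (norm_nonneg _)
    · simp [image_eq_zero_of_notMem_tsupport hz]
  · refine Eventually.of_forall fun z => ?_
    have h1 : Tendsto (fun n => b n • z) atTop (𝓝 0) := by simpa using hb.smul_const z
    exact ((hg.tendsto 0).comp h1).const_mul _

/-- Integration by parts moves the derivative from P to the fixed bump D and gains the factor 1 / b
n. The remaining integral is bounded because P is, which is what decay at infinity is used for. -/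
theorem tendsto_blowdown {D P : E3 → ℝ} (hD : ContDiff ℝ 1 D) (hDc : HasCompactSupport D)
    (hP : ContDiff ℝ 1 P) (h0 : Tendsto P (cocompact E3) (𝓝 0)) (i : Fin 3) {b : ℕ → ℝ}
    (hb : Tendsto b atTop atTop) (hb0 : ∀ n, 0 < b n) :
    Tendsto (fun n => ∫ z, D z * pd i P (b n • z)) atTop (𝓝 0) := by
  obtain ⟨M, hM⟩ := exists_bound_of_tendsto_zero hP.continuous h0
  have hDi : Integrable (pd i D) := (continuous_pd hD).integrable_of_hasCompactSupport
    (hasCompactSupport_pd hDc (hD.differentiable (by simp)))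
  have key : ∀ n, ∫ z, D z * pd i P (b n • z)
      = (b n)⁻¹ * - ∫ z, pd i D z * P (b n • z) := by
    intro n
    have hPn : ContDiff ℝ 1 (fun z => P (b n • z)) := hP.comp (contDiff_const_smul _)
    rw [← integral_mul_pd hD hPn hDc, ← integral_const_mul]
    congr 1; ext z
    rw [pd_comp_smul (hP.differentiable (by simp))]
    field_simp [(hb0 n).ne']
  have hz : Tendsto (fun n => (b n)⁻¹ * ∫ z, |pd i D z| * M) atTop (𝓝 0) := by
    simpa using (tendsto_inv_atTop_zero.comp hb).mul_const (∫ z, |pd i D z| * M)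
  refine squeeze_zero_norm (fun n => ?_) hz
  rw [key, norm_mul, norm_neg, Real.norm_of_nonneg (inv_nonneg.2 (hb0 n).le)]
  refine mul_le_mul_of_nonneg_left ?_ (inv_nonneg.2 (hb0 n).le)
  refine norm_integral_le_of_norm_le (hDi.abs.mul_const _) (Eventually.of_forall fun z => ?_)
  rw [norm_mul]
  exact mul_le_mul_of_nonneg_left (hM _) (norm_nonneg _)

theorem abs_kernel_le (z : E3) (i : Fin 3) :
    |z i / (4 * Real.pi * ‖z‖ ^ 3)| ≤ (‖z‖ ^ 2)⁻¹ := by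
  rcases eq_or_ne z 0 with rfl | hz
  · simp
  have hz' : 0 < ‖z‖ := norm_pos_iff.2 hz
  rw [abs_div, abs_of_pos (a := 4 * Real.pi * ‖z‖ ^ 3) (by positivity), div_le_iff₀ (by positivity)]
  have h1 := abs_coord_le_norm z i
  have h2 : (‖z‖ ^ 2)⁻¹ * (4 * Real.pi * ‖z‖ ^ 3) = 4 * Real.pi * ‖z‖ := by field_simp
  rw [h2]
  nlinarith [Real.pi_gt_three]

theorem pd_zero_eq_integral_kernel {P : E3 → ℝ} (hP : ContDiff ℝ 2 P)
    (h0 : Tendsto P (cocompact E3) (𝓝 0))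
    (hi : Integrable (fun y : E3 => (‖y‖ ^ 2)⁻¹ * |lap P y|)) (i : Fin 3) :
    pd i P 0 = ∫ y : E3, y i / (4 * Real.pi * ‖y‖ ^ 3) * (- lap P y) := by
  have hP1 : ContDiff ℝ 1 P := hP.of_le (by norm_num)
  have hgc : Continuous (pd i P) := continuous_pd hP1
  have hlapc : Continuous (lap P) := by
    unfold lap
    exact continuous_finsetSum _ fun k _ =>
      continuous_pd (contDiff_pd (n := 1) (by simpa using hP))
  set b : ℕ → ℝ := fun n => (n : ℝ) + 1 with hbdef
  have hb0 : ∀ n, 0 < b n := fun n => by positivity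
  have hb1 : ∀ n, 1 ≤ b n := fun n => by simp [hbdef]
  have hbt : Tendsto b atTop atTop :=
    tendsto_atTop_add_const_right _ _ tendsto_natCast_atTop_atTop
  have hbi : Tendsto (fun n => (b n)⁻¹) atTop (𝓝 0) := tendsto_inv_atTop_zero.comp hbt
  set D : E3 → ℝ := fun y => radialDiv cutProfile (‖y‖ ^ 2) with hDdef
  have hDs : ContDiff ℝ (⊤ : ℕ∞) D := contDiff_radial (contDiff_radialDiv contDiff_cutProfile)
  have hDc : HasCompactSupport D :=
    hasCompactSupport_radial (R := 2) fun s hs => radialDiv_cutProfile_of_ge hs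
  -- The difference of two scales is supported in a shell with radii of order 1/b and b, so it is
  -- smooth with compact support, and it equals the kernel well inside the shell. Its divergence is
  -- a concentrating bump minus a spreading one.
  set V : ℕ → ℝ → ℝ := fun n s => scaledProfile (b n) s - scaledProfile (b n)⁻¹ s with hVdef
  have hVs : ∀ n, ContDiff ℝ 1 (V n) := fun n =>
    ((contDiff_scaledProfile _).sub (contDiff_scaledProfile _)).of_le (by exact_mod_cast le_top)
  have hVR : ∀ n s, b n ^ 2 ≤ s → V n s = 0 := by
    intro n s hs
    have hs0 : 0 ≤ s := le_trans (by positivity) hs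
    have hs1 : 1 ≤ s := le_trans (one_le_pow₀ (hb1 n)) hs
    have e1 : 1 ≤ b n ^ 2 * s := by
      nlinarith [one_le_pow₀ (hb1 n) (n := 2)]
    have e2 : 1 ≤ (b n)⁻¹ ^ 2 * s := by
      rw [inv_pow, inv_mul_eq_div, le_div_iff₀ (by have := hb0 n; positivity)]; simpa using hs
    simp only [hVdef]
    rw [scaledProfile_of_ge (hb0 n) hs0 e1, scaledProfile_of_ge (inv_pos.2 (hb0 n)) hs0 e2,
      sub_self]
  have hint : ∀ a : ℝ, 0 < a → Integrable (fun y : E3 => a ^ 3 * D (a • y) * pd i P y) := by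
    intro a ha
    have hc : HasCompactSupport (fun y : E3 => D (a • y)) := hDc.comp_smul ha.ne'
    have hc2 : Continuous (fun y : E3 => D (a • y)) := hDs.continuous.comp (continuous_const_smul a)
    exact ((continuous_const.mul hc2).mul hgc).integrable_of_hasCompactSupport
      (hc.mul_left.mul_right)
  have key : ∀ n, ∫ y : E3, y i * V n (‖y‖ ^ 2) * (- lap P y)
      = (∫ z, D z * pd i P ((b n)⁻¹ • z)) - ∫ z, D z * pd i P (b n • z) := by
    intro n
    have e := integral_coord_radial_mul_lap (hVs n) (hVR n) hP i
    have e2 : ∀ y : E3, radialDiv (V n) (‖y‖ ^ 2) * pd i P y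
        = b n ^ 3 * D (b n • y) * pd i P y - (b n)⁻¹ ^ 3 * D ((b n)⁻¹ • y) * pd i P y := by
      intro y
      have hd : ∀ a, DifferentiableAt ℝ (scaledProfile a) (‖y‖ ^ 2) := fun a =>
        (contDiff_scaledProfile a).differentiable (by simp) _
      have : radialDiv (V n) (‖y‖ ^ 2)
          = radialDiv (scaledProfile (b n)) (‖y‖ ^ 2)
            - radialDiv (scaledProfile (b n)⁻¹) (‖y‖ ^ 2) := by
        simp only [radialDiv, hVdef]
        rw [deriv_fun_sub (hd _) (hd _)]
        ring
      rw [this, radialDiv_scaledProfile, radialDiv_scaledProfile]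
      simp only [hDdef, norm_smul, mul_pow, Real.norm_eq_abs, sq_abs]
      ring
    simp only [mul_neg, integral_neg, e, neg_neg, e2]
    rw [integral_sub (hint _ (hb0 n)) (hint _ (inv_pos.2 (hb0 n))),
      integral_scaled_mul (hb0 n), integral_scaled_mul (inv_pos.2 (hb0 n)), inv_inv]
  have lim1 : Tendsto (fun n => ∫ y : E3, y i * V n (‖y‖ ^ 2) * (- lap P y)) atTop
      (𝓝 (pd i P 0)) := by
    simp only [key]
    have t1 := tendsto_mollified hDs.continuous hDc hgc hbi (fun n => by
      rw [abs_of_pos (inv_pos.2 (hb0 n))]; exact inv_le_one_of_one_le₀ (hb1 n))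
    have t2 := tendsto_blowdown (hDs.of_le (by exact_mod_cast le_top)) hDc hP1 h0 i hbt hb0
    have t3 := t1.sub t2
    rw [show ∫ z, D z = 1 from integral_radialDiv_cutProfile] at t3
    simpa using t3
  have lim2 : Tendsto (fun n => ∫ y : E3, y i * V n (‖y‖ ^ 2) * (- lap P y)) atTop
      (𝓝 (∫ y : E3, y i / (4 * Real.pi * ‖y‖ ^ 3) * (- lap P y))) := by
    refine tendsto_integral_of_dominated_convergence (fun y => (‖y‖ ^ 2)⁻¹ * |lap P y|)
      (fun n => ?_) hi (fun n => ?_) ?_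
    · exact (((contDiff_coord (n := 1) i).continuous.mul
        (contDiff_radial (hVs n)).continuous).mul hlapc.neg).aestronglyMeasurable
    · refine Eventually.of_forall fun y => ?_
      rw [norm_mul, norm_neg, Real.norm_eq_abs, Real.norm_eq_abs]
      refine mul_le_mul_of_nonneg_right ?_ (abs_nonneg _)
      have hy0 : 0 ≤ ‖y‖ ^ 2 := by positivity
      have a1 := scaledProfile_nonneg (hb0 n) hy0
      have a2 := scaledProfile_le (hb0 n) hy0
      have a3 := scaledProfile_nonneg (inv_pos.2 (hb0 n)) hy0
      have a4 := scaledProfile_le (inv_pos.2 (hb0 n)) hy0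
      rw [norm_sq_rpow] at a2 a4
      -- Both profiles lie between 0 and the kernel, so their difference is dominated by one copy of
      -- the kernel.
      have a5 : |V n (‖y‖ ^ 2)| ≤ (‖y‖ ^ 3)⁻¹ / (4 * Real.pi) := by
        rw [abs_le]; constructor <;> simp only [hVdef] <;> linarith
      rcases eq_or_ne y 0 with rfl | hy
      · simp
      have hn : 0 < ‖y‖ := norm_pos_iff.2 hy
      rw [abs_mul]
      calc |y i| * |V n (‖y‖ ^ 2)| ≤ ‖y‖ * ((‖y‖ ^ 3)⁻¹ / (4 * Real.pi)) :=
            mul_le_mul (abs_coord_le_norm y i) a5 (abs_nonneg _) hn.le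
        _ = (‖y‖ ^ 2)⁻¹ / (4 * Real.pi) := by field_simp
        _ ≤ (‖y‖ ^ 2)⁻¹ := div_le_self (by positivity) (by linarith [Real.pi_gt_three])
    · refine Eventually.of_forall fun y => ?_
      rcases eq_or_ne y 0 with rfl | hy
      · simp
      have hy0 : 0 < ‖y‖ ^ 2 := by have := norm_pos_iff.2 hy; positivity
      refine Tendsto.mul_const _ (tendsto_const_nhds.congr' ?_)
      -- As b ≥ 1, these two bounds give b²|y|² ≥ 1 and |y|²/b² ≤ 1/2: eventually y lies where the
      -- fine cut-off is 1 and the coarse one is 0.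
      have c1 : ∀ᶠ n in atTop, (‖y‖ ^ 2)⁻¹ ≤ b n := hbt.eventually_ge_atTop _
      have c2 : ∀ᶠ n in atTop, 2 * ‖y‖ ^ 2 ≤ b n := hbt.eventually_ge_atTop _
      filter_upwards [c1, c2] with n h1 h2
      have hbn := hb1 n
      have e1 : 1 ≤ b n ^ 2 * ‖y‖ ^ 2 := by
        rw [← div_le_iff₀ hy0, one_div]; nlinarith
      have e2 : (b n)⁻¹ ^ 2 * ‖y‖ ^ 2 ≤ 1 / 2 := by
        rw [inv_pow, inv_mul_eq_div, div_le_iff₀ (by have := hb0 n; positivity)]; nlinarith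
      simp only [hVdef]
      rw [scaledProfile_of_ge (hb0 n) hy0.le e1, scaledProfile_of_le e2, norm_sq_rpow]
      field_simp
      simp
  exact tendsto_nhds_unique lim1 lim2

/-- Around the origin, the Jacobian r² cancels the singularity and leaves (1+r)^(-β), integrable for
β > 1. The general centre reduces to this through 1+|y−x| ≤ (1+|x|)(1+|y|). -/
theorem integrable_newton_envelope {β : ℝ} (hβ : 1 < β) (x : E3) :
    Integrable (fun y : E3 => (‖y - x‖ ^ 2)⁻¹ * (1 + ‖y‖) ^ (-β)) := by
  have base : Integrable (fun z : E3 => (‖z‖ ^ 2)⁻¹ * (1 + ‖z‖) ^ (-β)) := by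
    rw [integrable_fun_norm_addHaar (volume : Measure E3)
      (f := fun r : ℝ => (r ^ 2)⁻¹ * (1 + r) ^ (-β))]
    refine (integrableOn_add_rpow_Ioi_of_lt (a := -β) (c := 0) (m := 1) (by linarith)
      (by norm_num)).congr_fun (fun r hr => ?_) measurableSet_Ioi
    have : (0 : ℝ) < r := hr
    simp
    field_simp
    rw [add_comm]
  have h1 := (base.comp_sub_right x).mul_const ((1 + ‖x‖) ^ β)
  refine h1.mono' ?_ (Eventually.of_forall fun y => ?_)
  · apply Measurable.aestronglyMeasurable
    fun_prop
  · rw [Real.norm_of_nonneg (by positivity), mul_assoc]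
    refine mul_le_mul_of_nonneg_left ?_ (by positivity)
    have h2 : 1 + ‖y - x‖ ≤ (1 + ‖x‖) * (1 + ‖y‖) := by
      nlinarith [norm_sub_le y x, norm_nonneg x, norm_nonneg y,
        mul_nonneg (norm_nonneg x) (norm_nonneg y)]
    have h3 : (1 + ‖y - x‖) ^ β ≤ (1 + ‖x‖) ^ β * (1 + ‖y‖) ^ β := by
      rw [← Real.mul_rpow (by positivity) (by positivity)]
      exact Real.rpow_le_rpow (by positivity) h2 (by linarith)
    rw [Real.rpow_neg (by positivity), Real.rpow_neg (by positivity), inv_mul_eq_div,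
      inv_eq_one_div, div_le_div_iff₀ (by positivity) (by positivity)]
    linarith

/-- Green's representation of the gradient of a function vanishing at infinity. -/
theorem pd_eq_integral_kernel {P : E3 → ℝ} (hP : ContDiff ℝ 2 P)
    (h0 : Tendsto P (cocompact E3) (𝓝 0)) {β C : ℝ} (hβ : 1 < β)
    (hb : ∀ y, |lap P y| ≤ C * (1 + ‖y‖) ^ (-β)) (i : Fin 3) (x : E3) :
    pd i P x = ∫ y : E3, (y i - x i) / (4 * Real.pi * ‖y - x‖ ^ 3) * (- lap P y) := by
  have hpd : ∀ (f : E3 → ℝ) (k : Fin 3) (z : E3), pd k (fun z => f (x + z)) z = pd k f (x + z) := by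
    intro f k z
    simp only [pd, lineDeriv, add_assoc]
  have hlap : ∀ z, lap (fun z => P (x + z)) z = lap P (x + z) := by
    intro z
    simp only [lap]
    refine Finset.sum_congr rfl fun k _ => ?_
    rw [show pd k (fun z => P (x + z)) = fun z => pd k P (x + z) from funext (hpd P k), hpd]
  have hlapc : Continuous (lap P) := by
    unfold lap
    exact continuous_finsetSum _ fun k _ =>
      continuous_pd (contDiff_pd (n := 1) (by simpa using hP))
  have hi : Integrable (fun y : E3 => (‖y - x‖ ^ 2)⁻¹ * |lap P y|) := by
    refine ((integrable_newton_envelope hβ x).const_mul C).mono' ?_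
      (Eventually.of_forall fun y => ?_)
    · apply Measurable.aestronglyMeasurable
      have := hlapc.measurable
      fun_prop
    · rw [Real.norm_of_nonneg (by positivity), mul_left_comm]
      exact mul_le_mul_of_nonneg_left (hb y) (by positivity)
  have hi2 := hi.comp_add_left x
  simp only [add_sub_cancel_left] at hi2
  have hc : Tendsto (fun z => P (x + z)) (cocompact E3) (𝓝 0) :=
    h0.comp (Homeomorph.addLeft x).isClosedEmbedding.tendsto_cocompact
  have := pd_zero_eq_integral_kernel (P := fun z => P (x + z))
    (hP.comp (contDiff_const.add contDiff_id)) hc (by simpa only [hlap] using hi2) i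
  rw [hpd, add_zero] at this
  rw [this, ← integral_add_left_eq_self (μ := volume)
    (fun y : E3 => (y i - x i) / (4 * Real.pi * ‖y - x‖ ^ 3) * (- lap P y)) x]
  simp only [hlap, add_sub_cancel_left, PiLp.add_apply]

end TurbPDF

namespace TurbPDF

/-! ### Versions of conditional expectations -/

section CondExp

variable {Ω : Type*} [MeasurableSpace Ω] {μ : Measure Ω} [IsProbabilityMeasure μ]
  {X : Ω → E3}

theorem stronglyMeasurable_comap {g : E3 → ℝ} (hg : Measurable g) :
    StronglyMeasurable[MeasurableSpace.comap X inferInstance] (fun ω => g (X ω)) :=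
  (hg.comp (comap_measurable X)).stronglyMeasurable

namespace IsCondExpGiven

variable {Y Y' : Ω → ℝ} {g g' : E3 → ℝ}

theorem integrable_comp (h : IsCondExpGiven μ X Y g) : Integrable (fun ω => g (X ω)) μ :=
  integrable_condExp.congr h.2.2.symm

theorem self (hX : Measurable X) (hg : Measurable g) (hi : Integrable (fun ω => g (X ω)) μ) :
    IsCondExpGiven μ X (fun ω => g (X ω)) g := by
  refine ⟨hi, hg, ?_⟩
  rw [condExp_of_stronglyMeasurable hX.comap_le (stronglyMeasurable_comap hg) hi]

theorem add (h : IsCondExpGiven μ X Y g) (h' : IsCondExpGiven μ X Y' g') :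
    IsCondExpGiven μ X (fun ω => Y ω + Y' ω) (fun u => g u + g' u) :=
  ⟨h.1.add h'.1, h.2.1.add h'.2.1, (h.2.2.add h'.2.2).trans (condExp_add h.1 h'.1 _).symm⟩

theorem sub (h : IsCondExpGiven μ X Y g) (h' : IsCondExpGiven μ X Y' g') :
    IsCondExpGiven μ X (fun ω => Y ω - Y' ω) (fun u => g u - g' u) :=
  ⟨h.1.sub h'.1, h.2.1.sub h'.2.1, (h.2.2.sub h'.2.2).trans (condExp_sub h.1 h'.1 _).symm⟩

theorem const_mul (h : IsCondExpGiven μ X Y g) (c : ℝ) :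
    IsCondExpGiven μ X (fun ω => c * Y ω) (fun u => c * g u) :=
  ⟨h.1.const_mul c, h.2.1.const_mul c, (h.2.2.const_smul c).trans (condExp_smul c Y _).symm⟩

theorem sum {ι : Type*} (s : Finset ι) {Y : ι → Ω → ℝ} {g : ι → E3 → ℝ}
    (h : ∀ i ∈ s, IsCondExpGiven μ X (Y i) (g i)) (hX : Measurable X) :
    IsCondExpGiven μ X (fun ω => ∑ i ∈ s, Y i ω) (fun u => ∑ i ∈ s, g i u) := by
  classical
  induction s using Finset.induction_on with
  | empty => simpa using self (μ := μ) (g := fun _ => 0) hX measurable_const (integrable_zero _ _ _)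
  | insert a s ha ih =>
    simp only [Finset.sum_insert ha]
    exact (h a (Finset.mem_insert_self _ _)).add
      (ih fun i hi => h i (Finset.mem_insert_of_mem hi))

theorem mul_left (h : IsCondExpGiven μ X Y g) {ψ : E3 → ℝ} (hψ : Measurable ψ)
    (hi : Integrable (fun ω => ψ (X ω) * Y ω) μ) :
    IsCondExpGiven μ X (fun ω => ψ (X ω) * Y ω) (fun u => ψ u * g u) := by
  refine ⟨hi, hψ.mul h.2.1, ?_⟩
  have := condExp_mul_of_stronglyMeasurable_left (μ := μ) (stronglyMeasurable_comap (X := X) hψ)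
    hi h.1
  filter_upwards [this, h.2.2] with ω h1 h2
  rw [h2]
  exact h1.symm

theorem integral_eq (h : IsCondExpGiven μ X Y g) (hX : Measurable X) :
    ∫ ω, Y ω ∂μ = ∫ ω, g (X ω) ∂μ := by
  rw [integral_congr_ae h.2.2, integral_condExp hX.comap_le]

theorem integral_abs_le (h : IsCondExpGiven μ X Y g) :
    ∫ ω, |g (X ω)| ∂μ ≤ ∫ ω, |Y ω| ∂μ := by
  have : ∫ ω, |g (X ω)| ∂μ
      = ∫ ω, |(μ[Y | MeasurableSpace.comap X inferInstance]) ω| ∂μ :=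
    integral_congr_ae (h.2.2.mono fun ω hω => by simp only [hω])
  rw [this]
  exact integral_abs_condExp_le Y

theorem integral_mul_eq (h : IsCondExpGiven μ X Y g) (hX : Measurable X) {φ : E3 → ℝ}
    (hφ : Measurable φ) {c : ℝ} (hc : ∀ u, |φ u| ≤ c) :
    ∫ ω, φ (X ω) * Y ω ∂μ = ∫ ω, φ (X ω) * g (X ω) ∂μ :=
  (h.mul_left hφ (h.1.bdd_mul (c := c) (hφ.comp hX).aestronglyMeasurable
    (Eventually.of_forall fun _ => hc _))).integral_eq hX

/-- Dominated convergence for versions of conditional expectations. -/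
theorem of_tendsto (hX : Measurable X) {Y : ℕ → Ω → ℝ} {Yl : Ω → ℝ} {g : ℕ → E3 → ℝ}
    {gl : E3 → ℝ} {W : Ω → ℝ} (h : ∀ n, IsCondExpGiven μ X (Y n) (g n)) (hW : Integrable W μ)
    (hb : ∀ n ω, |Y n ω| ≤ W ω) (hY : ∀ ω, Tendsto (fun n => Y n ω) atTop (𝓝 (Yl ω)))
    (hg : ∀ u, Tendsto (fun n => g n u) atTop (𝓝 (gl u))) : IsCondExpGiven μ X Yl gl := by
  have hglm : Measurable gl :=
    measurable_of_tendsto_metrizable (fun n => (h n).2.1) (tendsto_pi_nhds.2 hg)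
  have hYl : Integrable Yl μ := by
    refine hW.mono' (aestronglyMeasurable_of_tendsto_ae atTop
      (fun n => (h n).1.aestronglyMeasurable) (Eventually.of_forall hY))
      (Eventually.of_forall fun ω => ?_)
    exact le_of_tendsto (hY ω).norm (Eventually.of_forall fun n => hb n ω)
  -- The versions inherit from W the almost sure dominating function E[W | X].
  have hgb : ∀ n, ∀ᵐ ω ∂μ,
      ‖g n (X ω)‖ ≤ (μ[W | MeasurableSpace.comap X inferInstance]) ω := by
    intro n
    have h1 := abs_condExp_ae_le_condExp_abs (μ := μ)
      (m := MeasurableSpace.comap X inferInstance) (Y n)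
    have h2 := condExp_mono (m := MeasurableSpace.comap X inferInstance) (h n).1.abs hW
      (Eventually.of_forall fun ω => hb n ω)
    filter_upwards [h1, h2, (h n).2.2] with ω a1 a2 a3
    rw [a3]
    exact a1.trans a2
  have hgl : Integrable (fun ω => gl (X ω)) μ := by
    refine (integrable_condExp (μ := μ) (f := W)
      (m := MeasurableSpace.comap X inferInstance)).mono'
      (hglm.comp hX).aestronglyMeasurable ?_
    -- The bounds hold for all n off a single null set, so they pass to the limit version.
    filter_upwards [ae_all_iff.2 hgb] with ω hω
    exact le_of_tendsto (hg (X ω)).norm (Eventually.of_forall hω)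
  refine ⟨hYl, hglm, ?_⟩
  have := tendsto_condExp_unique (m := MeasurableSpace.comap X inferInstance) (μ := μ)
    Y (fun n ω => g n (X ω)) Yl (fun ω => gl (X ω)) (fun n => (h n).1)
    (fun n => (h n).integrable_comp) (Eventually.of_forall hY)
    (Eventually.of_forall fun ω => hg (X ω)) W hW _ integrable_condExp
    (fun n => Eventually.of_forall (hb n)) hgb (fun n => by
      rw [condExp_of_stronglyMeasurable hX.comap_le (stronglyMeasurable_comap (h n).2.1)
        (h n).integrable_comp]
      exact (h n).2.2.symm)
  rw [condExp_of_stronglyMeasurable hX.comap_le (stronglyMeasurable_comap hglm) hgl] at this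
  exact this.symm

/-- Versions of conditional expectations that are differentiable in a parameter may be
differentiated in it. -/
theorem deriv_param (hX : Measurable X) {f : E3 → Ω → ℝ} {g : E3 → E3 → ℝ} {W : Ω → ℝ} {k : Fin 3}
    (h : ∀ y, IsCondExpGiven μ X (f y) (g y)) (hW : Integrable W μ)
    (hf : ∀ ω, Differentiable ℝ (fun y => f y ω))
    (hb : ∀ ω y, |pd k (fun y => f y ω) y| ≤ W ω)
    (hg : ∀ u, Differentiable ℝ (fun y => g y u)) (y : E3) :
    IsCondExpGiven μ X (fun ω => pd k (fun y => f y ω) y)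
      (fun u => pd k (fun y => g y u) y) :=
  of_tendsto hX (Y := fun n ω => dq k n (fun y => f y ω) y)
    (g := fun n u => dq k n (fun y => g y u) y)
    (fun _ => ((h _).sub (h _)).const_mul _) hW (fun n ω => abs_dq_le (hf ω) (hb ω) n y)
    (fun ω => tendsto_dq (hf ω y)) (fun u => tendsto_dq (hg u y))

theorem memLp_two (h : IsCondExpGiven μ X Y g) (hY : MemLp Y 2 μ) :
    MemLp (fun ω => g (X ω)) 2 μ :=
  (hY.condExp (by norm_num)).ae_eq h.2.2.symm

/-- The conditional second moment is the conditional covariance plus the product of the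
conditional means. -/
theorem second_moment (hX : Measurable X) {Yj Yk : Ω → ℝ} {bj bk s : E3 → ℝ}
    (hj : IsCondExpGiven μ X Yj bj) (hk : IsCondExpGiven μ X Yk bk)
    (hj2 : MemLp Yj 2 μ) (hk2 : MemLp Yk 2 μ)
    (hs : IsCondExpGiven μ X (fun ω => (Yj ω - bj (X ω)) * (Yk ω - bk (X ω))) s) :
    IsCondExpGiven μ X (fun ω => Yj ω * Yk ω) (fun u => s u + bj u * bk u) := by
  have mj := hj.memLp_two hj2
  have mk := hk.memLp_two hk2
  -- YⱼYₖ = (Yⱼ−bⱼ)(Yₖ−bₖ) + bⱼYₖ + bₖYⱼ − bⱼbₖ. Square integrability of the conditional means makes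
  -- each product integrable.
  have c1 := hk.mul_left hj.2.1 (mj.integrable_mul hk2)
  have c2 := hj.mul_left hk.2.1 (mk.integrable_mul hj2)
  have c3 := self (g := fun u => bj u * bk u) hX (hj.2.1.mul hk.2.1) (mj.integrable_mul mk)
  convert! ((hs.add c1).add c2).sub c3 using 1
  · ext ω; ring
  · ext u; ring

end IsCondExpGiven

end CondExp

end TurbPDF

namespace TurbPDF

/-! ### Consequences of the Navier-Stokes equations along one path -/

/-- `∂ⱼ∂ₖ (vʲ vᵏ)`, summed over both indices. -/
noncomputable def quadSource (v : E3 → E3) (y : E3) : ℝ :=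
  ∑ j : Fin 3, ∑ k : Fin 3, pd k (pd j (fun y' => v y' j * v y' k)) y

/-- The field `v` and its derivatives up to order two are bounded by `z (1 + |x|) ^ (-α)`. -/
def EnvelopeBound (α z : ℝ) (v : E3 → E3) : Prop :=
  ∀ (x : E3) (i j k : Fin 3),
    |v x i| ≤ z * (1 + ‖x‖) ^ (-α) ∧
    |pd j (fun y => v y i) x| ≤ z * (1 + ‖x‖) ^ (-α) ∧
    |pd k (pd j (fun y => v y i)) x| ≤ z * (1 + ‖x‖) ^ (-α)

theorem envelope_le_one {α : ℝ} (hα : 0 ≤ α) (x : E3) : (1 + ‖x‖) ^ (-α) ≤ 1 :=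
  Real.rpow_le_one_of_one_le_of_nonpos (by linarith [norm_nonneg x]) (by linarith)

theorem EnvelopeBound.nonneg {α z : ℝ} {v : E3 → E3} (h : EnvelopeBound α z v) : 0 ≤ z := by
  have := (abs_nonneg _).trans (h 0 0 0 0).1
  simpa using this

theorem EnvelopeBound.le {α z : ℝ} {v : E3 → E3} (hα : 0 ≤ α) (h : EnvelopeBound α z v) (x : E3)
    (i j k : Fin 3) : |v x i| ≤ z ∧ |pd j (fun y => v y i) x| ≤ z ∧
      |pd k (pd j (fun y => v y i)) x| ≤ z := by
  have h1 : z * (1 + ‖x‖) ^ (-α) ≤ z := mul_le_of_le_one_right h.nonneg (envelope_le_one hα x)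
  exact ⟨(h x i j k).1.trans h1, (h x i j k).2.1.trans h1, (h x i j k).2.2.trans h1⟩

theorem pd_pd_mul {f g : E3 → ℝ} (hf : TwiceDifferentiable f) (hg : TwiceDifferentiable g)
    (j k : Fin 3) (y : E3) :
    pd k (pd j (fun y' => f y' * g y')) y
      = f y * pd k (pd j g) y + pd k f y * pd j g y + (pd j f y * pd k g y
        + pd k (pd j f) y * g y) := by
  have : pd j (fun y' => f y' * g y') = fun y => f y * pd j g y + pd j f y * g y :=
    funext fun y => pd_mul (hf.1 y) (hg.1 y)
  rw [this, pd_add ((hf.1 y).fun_mul (hg.differentiable_pd j y))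
    ((hf.differentiable_pd j y).fun_mul (hg.1 y)), pd_mul (hf.1 y) (hg.differentiable_pd j y),
    pd_mul (hf.differentiable_pd j y) (hg.1 y)]

theorem abs_pd_mul_le {α z : ℝ} {v : E3 → E3} (h : EnvelopeBound α z v)
    (hv : ∀ i, TwiceDifferentiable (fun y => v y i)) (j k l : Fin 3) (y : E3) :
    |pd l (fun y' => v y' j * v y' k) y| ≤ 2 * z ^ 2 * (1 + ‖y‖) ^ (-(2 * α)) := by
  have e : (1 + ‖y‖) ^ (-(2 * α)) = (1 + ‖y‖) ^ (-α) * (1 + ‖y‖) ^ (-α) := by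
    rw [← Real.rpow_add (by positivity)]; ring_nf
  rw [pd_mul ((hv j).1 y) ((hv k).1 y), e]
  refine (abs_add_le _ _).trans ?_
  rw [abs_mul, abs_mul]
  have h1 := mul_le_mul (h y j j j).1 (h y k l l).2.1 (abs_nonneg _) ((abs_nonneg _).trans (h y j j j).1)
  have h2 := mul_le_mul (h y j l l).2.1 (h y k k k).1 (abs_nonneg _) ((abs_nonneg _).trans (h y j j j).1)
  linarith

theorem abs_pd_pd_mul_le {α z : ℝ} {v : E3 → E3} (h : EnvelopeBound α z v)
    (hv : ∀ i, TwiceDifferentiable (fun y => v y i)) (j k l m : Fin 3) (y : E3) :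
    |pd l (pd m (fun y' => v y' j * v y' k)) y| ≤ 4 * z ^ 2 * (1 + ‖y‖) ^ (-(2 * α)) := by
  have e : (1 + ‖y‖) ^ (-(2 * α)) = (1 + ‖y‖) ^ (-α) * (1 + ‖y‖) ^ (-α) := by
    rw [← Real.rpow_add (by positivity)]; ring_nf
  rw [pd_pd_mul (hv j) (hv k), e]
  refine (abs_add_le _ _).trans ((add_le_add (abs_add_le _ _) (abs_add_le _ _)).trans ?_)
  simp only [abs_mul]
  have h0 := (abs_nonneg _).trans (h y j j j).1
  have h1 := mul_le_mul (h y j j j).1 (h y k m l).2.2 (abs_nonneg _) h0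
  have h2 := mul_le_mul (h y j l l).2.1 (h y k m m).2.1 (abs_nonneg _) h0
  have h3 := mul_le_mul (h y j m m).2.1 (h y k l l).2.1 (abs_nonneg _) h0
  have h4 := mul_le_mul (h y j m l).2.2 (h y k k k).1 (abs_nonneg _) h0
  linarith

/-- Nine index pairs with four Leibniz terms each give 36. Every term is a product of two enveloped
factors, which doubles the decay exponent. -/
theorem abs_quadSource_le {α z : ℝ} {v : E3 → E3} (h : EnvelopeBound α z v)
    (hv : ∀ i, TwiceDifferentiable (fun y => v y i)) (y : E3) :
    |quadSource v y| ≤ 36 * z ^ 2 * (1 + ‖y‖) ^ (-(2 * α)) := by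
  have h1 : ∀ j ∈ (Finset.univ : Finset (Fin 3)),
      |∑ k : Fin 3, pd k (pd j (fun y' => v y' j * v y' k)) y|
        ≤ 3 * (4 * z ^ 2 * (1 + ‖y‖) ^ (-(2 * α))) := fun j _ => by
    refine (Finset.abs_sum_le_sum_abs _ _).trans
      ((Finset.sum_le_card_nsmul _ _ _ fun k _ => abs_pd_pd_mul_le h hv j k k j y).trans ?_)
    simp
  refine (Finset.abs_sum_le_sum_abs _ _).trans
    ((Finset.sum_le_card_nsmul _ _ _ h1).trans ?_)
  simp
  linarith

section Path

variable {ν : ℝ} {V : E3 → ℝ → E3} {Pr : E3 → ℝ → ℝ} {V₀ : E3 → E3}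

namespace SmoothDecaying

theorem contDiffAt_component (h : SmoothDecaying V Pr) (i : Fin 3) (x : E3) {t : ℝ} (ht : 0 < t) :
    ContDiffAt ℝ 3 (fun z : E3 × ℝ => V z.1 z.2 i) (x, t) := by
  have h1 := h.velocity_smooth.contDiffAt
    ((isOpen_univ.prod isOpen_Ioi).mem_nhds (show (x, t) ∈ univ ×ˢ Ioi (0 : ℝ) from ⟨trivial, ht⟩))
  exact contDiffAt_euclidean.1 h1 i

theorem contDiff_space (h : SmoothDecaying V Pr) (i : Fin 3) {t : ℝ} (ht : 0 < t) :
    ContDiff ℝ 3 (fun y => V y t i) :=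
  contDiff_iff_contDiffAt.2 fun x =>
    (h.contDiffAt_component i x ht).comp x (f := fun y : E3 => (y, t)) (by fun_prop)

theorem contDiff_pressure (h : SmoothDecaying V Pr) {t : ℝ} (ht : 0 < t) :
    ContDiff ℝ 2 (fun y => Pr y t) :=
  contDiff_iff_contDiffAt.2 fun x =>
    (h.pressure_smooth.contDiffAt ((isOpen_univ.prod isOpen_Ioi).mem_nhds
      (show (x, t) ∈ univ ×ˢ Ioi (0 : ℝ) from ⟨trivial, ht⟩))).comp x
      (f := fun y : E3 => (y, t)) (by fun_prop)

theorem hasDerivAt_time (h : SmoothDecaying V Pr) (i : Fin 3) (x : E3) {t : ℝ} (ht : 0 < t) :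
    HasDerivAt (fun s => V x s i) (deriv (fun s => V x s i) t) t := by
  have h1 : ContDiffAt ℝ 3 (fun s => V x s i) t :=
    (h.contDiffAt_component i x ht).comp t (f := fun s : ℝ => (x, s)) (by fun_prop)
  exact (h1.differentiableAt (by simp)).hasDerivAt

end SmoothDecaying

theorem pd_slice_eq_fderiv {f : E3 × ℝ → ℝ} {x : E3} {t : ℝ} (hf : DifferentiableAt ℝ f (x, t))
    (i : Fin 3) : pd i (fun y => f (y, t)) x = fderiv ℝ f (x, t) (EuclideanSpace.single i 1, 0) := by
  have h1 : HasFDerivAt (fun y : E3 => (y, t)) (ContinuousLinearMap.inl ℝ E3 ℝ) x :=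
    hasFDerivAt_prodMk_left x t
  have h2 := HasFDerivAt.comp (f := fun y : E3 => (y, t)) x hf.hasFDerivAt h1
  rw [pd_eq_fderiv (f := fun y => f (y, t)) h2.differentiableAt]
  have h3 : fderiv ℝ (fun y => f (y, t)) x = _ := h2.fderiv
  rw [h3]; simp

theorem deriv_slice_eq_fderiv {f : E3 × ℝ → ℝ} {x : E3} {t : ℝ}
    (hf : DifferentiableAt ℝ f (x, t)) :
    deriv (fun s => f (x, s)) t = fderiv ℝ f (x, t) (0, 1) := by
  have h1 : HasFDerivAt (fun s : ℝ => (x, s)) (ContinuousLinearMap.inr ℝ E3 ℝ) t :=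
    hasFDerivAt_prodMk_right x t
  have h2 := (HasFDerivAt.comp (f := fun s : ℝ => (x, s)) t hf.hasFDerivAt h1).hasDerivAt
  have h3 : deriv (fun s => f (x, s)) t = _ := h2.deriv
  rw [h3]; simp

/-- Both mixed derivatives are values of one second Fréchet derivative on space-time, symmetric for
a C² function. It serves to take the divergence of ∂ₜU. -/
theorem pd_deriv_comm {f : E3 × ℝ → ℝ} {t : ℝ} (hf : ∀ x, ∀ s, 0 < s → ContDiffAt ℝ 2 f (x, s))
    (ht : 0 < t) (i : Fin 3) (x : E3) :
    DifferentiableAt ℝ (fun y => deriv (fun s => f (y, s)) t) x ∧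
    pd i (fun y => deriv (fun s => f (y, s)) t) x
      = deriv (fun s => pd i (fun y => f (y, s)) x) t := by
  have hd : ∀ x, ∀ s, 0 < s → DifferentiableAt ℝ f (x, s) := fun x s hs =>
    (hf x s hs).differentiableAt (by simp)
  have hd2 : DifferentiableAt ℝ (fderiv ℝ f) (x, t) :=
    ((hf x t ht).fderiv_right (m := 1) (by norm_num)).differentiableAt (by simp)
  have hda : ∀ v : E3 × ℝ, DifferentiableAt ℝ (fun z => fderiv ℝ f z v) (x, t) := fun v =>
    hd2.clm_apply (differentiableAt_const _)
  have hfa : ∀ v w : E3 × ℝ, fderiv ℝ (fun z => fderiv ℝ f z v) (x, t) w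
      = fderiv ℝ (fderiv ℝ f) (x, t) w v := by
    intro v w
    rw [fderiv_clm_apply hd2 (differentiableAt_const _)]
    simp
  have e1 : (fun y => deriv (fun s => f (y, s)) t) = fun y => fderiv ℝ f (y, t) (0, 1) :=
    funext fun y => deriv_slice_eq_fderiv (hd y t ht)
  have e2 : (fun s => pd i (fun y => f (y, s)) x)
      =ᶠ[𝓝 t] fun s => fderiv ℝ f (x, s) (EuclideanSpace.single i 1, 0) := by
    filter_upwards [Ioi_mem_nhds ht] with s hs using pd_slice_eq_fderiv (hd x s hs) i
  rw [e1, e2.deriv_eq]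
  refine ⟨?_, ?_⟩
  · exact DifferentiableAt.comp x (f := fun y : E3 => (y, t)) (hda (0, 1)) (by fun_prop)
  · rw [pd_slice_eq_fderiv (f := fun z => fderiv ℝ f z (0, 1)) (hda _),
      deriv_slice_eq_fderiv (f := fun z => fderiv ℝ f z (EuclideanSpace.single i 1, 0)) (hda _),
      hfa, hfa]
    exact ((hf x t ht).isSymmSndFDerivAt (by simp)).eq _ _

/-- The pressure Poisson equation. -/
theorem lap_pressure (hNS : SolvesNavierStokes ν V Pr V₀) (h : SmoothDecaying V Pr) {t : ℝ}
    (ht : 0 < t) (x : E3) :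
    lap (fun y => Pr y t) x = - quadSource (fun y => V y t) x := by
  set v : Fin 3 → E3 → ℝ := fun i y => V y t i with hvdef
  have hv3 : ∀ i, ContDiff ℝ 3 (v i) := fun i => h.contDiff_space i ht
  have hv2 : ∀ i, ContDiff ℝ 2 (v i) := fun i => (hv3 i).of_le (by norm_num)
  have hvd : ∀ i, Differentiable ℝ (v i) := fun i => (hv3 i).differentiable (by simp)
  have hp1 : ∀ i k, ContDiff ℝ 2 (pd k (v i)) := fun i k =>
    contDiff_pd (n := 2) (by simpa using hv3 i)
  have hp2 : ∀ i k l, ContDiff ℝ 1 (pd l (pd k (v i))) := fun i k l =>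
    contDiff_pd (n := 1) (by simpa using hp1 i k)
  have hdiv : ∀ s, 0 < s → ∀ y, ∑ i : Fin 3, pd i (fun z => V z s i) y = 0 := fun s hs y =>
    hNS.incompressible y s hs
  have hprod : ∀ i j, ContDiff ℝ (1 + 1 : ℕ) (fun y => v i y * v j y) := fun i j =>
    (hv2 i).mul (hv2 j)
  have hpprod : ∀ i j k, ContDiff ℝ 1 (pd k (fun y => v i y * v j y)) := fun i j k =>
    contDiff_pd (n := 1) (hprod i j)
  -- Incompressibility puts the convection term in divergence form, Uʲ∂ⱼUⁱ = ∂ⱼ(UʲUⁱ).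
  have hconv : ∀ i y, ∑ j : Fin 3, v j y * pd j (v i) y
      = ∑ j : Fin 3, pd j (fun y' => v j y' * v i y') y := by
    intro i y
    have e : ∑ j : Fin 3, pd j (v j) y * v i y = 0 := by
      rw [← Finset.sum_mul, hdiv t ht y, zero_mul]
    rw [← add_zero (∑ j : Fin 3, v j y * pd j (v i) y), ← e, ← Finset.sum_add_distrib]
    exact Finset.sum_congr rfl fun j _ => (pd_mul (hvd j y) (hvd i y)).symm
  have hgrad : ∀ i, pd i (fun y => Pr y t) = fun y => ν * (∑ k : Fin 3, pd k (pd k (v i)) y)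
      - (deriv (fun s => V y s i) t + ∑ j : Fin 3, pd j (fun y' => v j y' * v i y') y) := by
    intro i; ext y
    have := hNS.momentum y t ht i
    rw [← hconv]
    simp only [lap] at this
    linarith
  have htime := fun i y => pd_deriv_comm (f := fun z : E3 × ℝ => V z.1 z.2 i)
    (fun x s hs => (h.contDiffAt_component i x hs).of_le (by norm_num)) ht i y
  have hlapd : ∀ i y, DifferentiableAt ℝ (fun y => ∑ k : Fin 3, pd k (pd k (v i)) y) y :=
    fun i y => DifferentiableAt.fun_sum fun k _ => (hp2 i k k).differentiable (by simp) y
  have hconvd : ∀ i y, DifferentiableAt ℝ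
      (fun y => ∑ j : Fin 3, pd j (fun y' => v j y' * v i y') y) y :=
    fun i y => DifferentiableAt.fun_sum fun k _ => (hpprod k i k).differentiable (by simp) y
  have hii : ∀ i, pd i (pd i (fun y => Pr y t)) x
      = ν * (∑ k : Fin 3, pd k (pd k (pd i (v i))) x)
        - (deriv (fun s => pd i (fun y => V y s i) x) t
          + ∑ j : Fin 3, pd i (pd j (fun y' => v j y' * v i y')) x) := by
    intro i
    rw [hgrad, pd_sub ((hlapd i x).const_mul ν) ((htime i x).1.fun_add (hconvd i x)),
      pd_add (htime i x).1 (hconvd i x), pd_const_mul ν (hlapd i x), (htime i x).2,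
      pd_sum fun k _ => (hp2 i k k).differentiable (by simp) x,
      pd_sum fun k _ => (hpprod k i k).differentiable (by simp) x]
    congr 2
    refine Finset.sum_congr rfl fun k _ => ?_
    rw [pd_comm (hp1 i k) x]
    congr 1; ext y
    exact pd_comm (hv2 i) y
  -- After exchanging derivatives, the viscous term is the Laplacian of div U, hence zero; `z2` is
  -- the analogous statement for ∂ₜ div U.
  have z1 : ∑ i : Fin 3, ∑ k : Fin 3, pd k (pd k (pd i (v i))) x = 0 := by
    rw [Finset.sum_comm]
    refine Finset.sum_eq_zero fun k _ => ?_
    rw [← pd_sum fun i _ => (hp2 i i k).differentiable (by simp) x]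
    have e : (fun y => ∑ i : Fin 3, pd k (pd i (v i)) y) = fun _ => 0 := by
      ext y
      rw [← pd_sum fun i _ => (hp1 i i).differentiable (by simp) y]
      have : (fun y => ∑ i : Fin 3, pd i (v i) y) = fun _ => 0 := funext (hdiv t ht)
      rw [this, pd_zero]
    rw [e, pd_zero]
  have z2 : ∑ i : Fin 3, deriv (fun s => pd i (fun y => V y s i) x) t = 0 := by
    have hd : ∀ i, DifferentiableAt ℝ (fun s => pd i (fun y => V y s i) x) t := by
      intro i
      have e2 : (fun s => pd i (fun y => V y s i) x) =ᶠ[𝓝 t] fun s =>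
          fderiv ℝ (fun z : E3 × ℝ => V z.1 z.2 i) (x, s) (EuclideanSpace.single i 1, 0) := by
        filter_upwards [Ioi_mem_nhds ht] with s hs
        exact pd_slice_eq_fderiv (f := fun z : E3 × ℝ => V z.1 z.2 i)
          ((h.contDiffAt_component i x hs).differentiableAt (by simp)) i
      refine DifferentiableAt.congr_of_eventuallyEq ?_ e2
      have := ((h.contDiffAt_component i x ht).fderiv_right (m := 1) (by norm_num)).differentiableAt
        (by simp)
      exact (this.comp t (f := fun s : ℝ => (x, s)) (by fun_prop)).clm_apply
        (differentiableAt_const _)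
    rw [← deriv_fun_sum fun i _ => hd i]
    have : (fun s => ∑ i : Fin 3, pd i (fun y => V y s i) x) =ᶠ[𝓝 t] fun _ => 0 := by
      filter_upwards [Ioi_mem_nhds ht] with s hs using hdiv s hs x
    rw [this.deriv_eq, deriv_const]
  unfold lap quadSource
  rw [Finset.sum_congr rfl fun i _ => hii i, Finset.sum_sub_distrib, Finset.sum_add_distrib,
    ← Finset.mul_sum, z1, z2]
  rw [Finset.sum_comm]
  simp [hvdef]

/-- The pressure gradient as a singular integral of the velocity. -/
theorem pd_pressure (hNS : SolvesNavierStokes ν V Pr V₀) (h : SmoothDecaying V Pr) {t α z : ℝ}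
    (ht : 0 < t) (hα : 1 / 2 < α) (hz : EnvelopeBound α z (fun y => V y t)) (i : Fin 3) (x : E3) :
    pd i (fun y => Pr y t) x = ∫ y : E3, (y i - x i) / (4 * Real.pi * ‖y - x‖ ^ 3)
      * quadSource (fun y => V y t) y := by
  have h2 : ∀ i, TwiceDifferentiable (fun y => V y t i) := fun i =>
    twiceDifferentiable_of_contDiff ((h.contDiff_space i ht).of_le (by norm_num))
  have := pd_eq_integral_kernel (h.contDiff_pressure ht) (h.pressure_decay t ht)
    (β := 2 * α) (C := 36 * z ^ 2) (by linarith) (fun y => by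
      rw [lap_pressure hNS h ht, abs_neg]; exact abs_quadSource_le hz h2 y) i x
  rw [this]
  simp only [lap_pressure hNS h ht, neg_neg]

/-- The Newtonian potential type integral of the envelope. -/
noncomputable def newtonConst (α : ℝ) (x : E3) : ℝ :=
  ∫ y : E3, (‖y - x‖ ^ 2)⁻¹ * (1 + ‖y‖) ^ (-(2 * α))

theorem abs_kernel_mul_le {q : ℝ} {α C : ℝ} {x y : E3} (i : Fin 3)
    (hq : |q| ≤ C * (1 + ‖y‖) ^ (-(2 * α))) :
    |(y i - x i) / (4 * Real.pi * ‖y - x‖ ^ 3) * q|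
      ≤ C * ((‖y - x‖ ^ 2)⁻¹ * (1 + ‖y‖) ^ (-(2 * α))) := by
  rw [abs_mul, mul_left_comm]
  exact mul_le_mul (abs_kernel_le (y - x) i) hq (abs_nonneg _) (by positivity)

theorem abs_pd_pressure_le (hNS : SolvesNavierStokes ν V Pr V₀) (h : SmoothDecaying V Pr)
    {t α z : ℝ} (ht : 0 < t) (hα : 1 / 2 < α) (hz : EnvelopeBound α z (fun y => V y t))
    (i : Fin 3) (x : E3) :
    |pd i (fun y => Pr y t) x| ≤ 36 * z ^ 2 * newtonConst α x := by
  have h2 : ∀ i, TwiceDifferentiable (fun y => V y t i) := fun i =>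
    twiceDifferentiable_of_contDiff ((h.contDiff_space i ht).of_le (by norm_num))
  rw [pd_pressure hNS h ht hα hz, newtonConst, ← integral_const_mul, ← Real.norm_eq_abs]
  exact norm_integral_le_of_norm_le
    ((integrable_newton_envelope (by linarith) x).const_mul _)
    (Eventually.of_forall fun y => abs_kernel_mul_le i (abs_quadSource_le hz h2 y))

/-- The envelope controls only spatial derivatives, so the time derivative is bounded by solving the
momentum equation for it. Convection and pressure are quadratic in z, which is why a square
integrable envelope gives an integrable bound. -/
theorem abs_deriv_velocity_le (hν : 0 ≤ ν) (hNS : SolvesNavierStokes ν V Pr V₀)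
    (h : SmoothDecaying V Pr) {t α z : ℝ} (ht : 0 < t) (hα : 1 / 2 < α)
    (hz : EnvelopeBound α z (fun y => V y t)) (i : Fin 3) (x : E3) :
    |deriv (fun s => V x s i) t| ≤ 3 * ν * z + (36 * newtonConst α x + 3) * z ^ 2 := by
  have hb := hz.le (by linarith : 0 ≤ α) x
  have e := hNS.momentum x t ht i
  have h1 : |∑ j : Fin 3, V x t j * pd j (fun y => V y t i) x| ≤ 3 * z ^ 2 := by
    refine (Finset.abs_sum_le_sum_abs _ _).trans ((Finset.sum_le_card_nsmul _ _ (z ^ 2)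
      fun j _ => ?_).trans (by simp))
    rw [abs_mul, sq]
    exact mul_le_mul (hb j j j).1 (hb i j j).2.1 (abs_nonneg _) hz.nonneg
  have h2 : |ν * lap (fun y => V y t i) x| ≤ ν * (3 * z) := by
    rw [abs_mul, abs_of_nonneg hν]
    refine mul_le_mul_of_nonneg_left ((Finset.abs_sum_le_sum_abs _ _).trans
      ((Finset.sum_le_card_nsmul _ _ z fun j _ => (hb i j j).2.2).trans (by simp))) hν
  have h3 := abs_pd_pressure_le hNS h ht hα hz i x
  rw [abs_le] at h1 h2 h3 ⊢
  constructor <;> nlinarith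

end Path

end TurbPDF

namespace TurbPDF

/-! ### Conditional expectation of the pressure gradient -/

theorem measurable_uncurry_pd {α : Type*} [MeasurableSpace α] {f : E3 → α → ℝ} (k : Fin 3)
    (hf : Measurable (Function.uncurry f)) (hd : ∀ a, Differentiable ℝ (fun y => f y a)) :
    Measurable (Function.uncurry fun y a => pd k (fun y => f y a) y) := by
  refine measurable_of_tendsto_metrizable
    (f := fun n (z : E3 × α) => dq k n (fun y => f y z.2) z.1) (fun n => ?_)
    (tendsto_pi_nhds.2 fun z => tendsto_dq (hd z.2 z.1))
  have h1 : Measurable fun z : E3 × α =>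
      f (z.1 + (1 / ((n : ℝ) + 1)) • EuclideanSpace.single k 1) z.2 :=
    hf.comp ((measurable_fst.add_const _).prodMk measurable_snd)
  have h2 : Measurable fun z : E3 × α => f z.1 z.2 := hf
  exact (h1.sub h2).const_mul _

/-- Continuity in y and measurability in the parameter give joint measurability of f, and difference
quotients preserve it. Fubini's theorem needs this both for the random source and for its
conditional version. -/
theorem measurable_uncurry_pd_pd {α : Type*} [MeasurableSpace α] {f : E3 → α → ℝ} (j k : Fin 3)
    (hf : ∀ y, Measurable (f y)) (hd : ∀ a, TwiceDifferentiable (fun y => f y a)) :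
    Measurable (Function.uncurry fun y a => pd k (pd j (fun y => f y a)) y) :=
  measurable_uncurry_pd (f := fun y a => pd j (fun y => f y a) y) k
    (measurable_uncurry_pd j
      (measurable_uncurry_of_continuous_of_measurable (fun a => (hd a).1.continuous) hf)
      fun a => (hd a).1) fun a => (hd a).differentiable_pd j

section

variable {Ω : Type*} [MeasurableSpace Ω] {μ : Measure Ω} [IsProbabilityMeasure μ] {X : Ω → E3}

/-- Fubini's theorem for a linear functional of a parametrised family of conditional
expectations. -/
theorem condExp_integral_param (hX : Measurable X) {S : E3 → Ω → ℝ} {h : E3 → E3 → ℝ}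
    {k e : E3 → ℝ} {W : Ω → ℝ} (hc : ∀ y, IsCondExpGiven μ X (S y) (h y))
    (hS : Measurable (Function.uncurry S)) (hh : Measurable (Function.uncurry h))
    (hk : Measurable k) (hW : Integrable W μ) (he : Integrable e)
    (hb : ∀ ω y, |k y * S y ω| ≤ W ω * e y) :
    (∀ᵐ u ∂(μ.map X), Integrable (fun y => k y * h y u)) ∧
    Integrable (fun u => ∫ y, k y * h y u) (μ.map X) ∧
    Integrable (fun ω => ∫ y, k y * S y ω) μ ∧
    ∀ φ : E3 → ℝ, Measurable φ → (∃ c, ∀ u, |φ u| ≤ c) →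
      ∫ ω, φ (X ω) * (∫ y, k y * S y ω) ∂μ = ∫ u, φ u * (∫ y, k y * h y u) ∂(μ.map X) := by
  have : IsProbabilityMeasure (μ.map X) := Measure.isProbabilityMeasure_map hX.aemeasurable
  have hhy : ∀ y, Measurable (h y) := fun y => (hc y).2.1
  have hm1 : Measurable fun z : E3 × E3 => k z.2 * h z.2 z.1 :=
    (hk.comp measurable_snd).mul (hh.comp measurable_swap)
  have hm2 : Measurable fun z : Ω × E3 => k z.2 * S z.2 z.1 :=
    (hk.comp measurable_snd).mul (hS.comp measurable_swap)
  have hlaw : ∀ y, Integrable (h y) (μ.map X) := fun y =>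
    (integrable_map_measure (hhy y).aestronglyMeasurable hX.aemeasurable).2
      (hc y).integrable_comp
  -- Conditional expectation contracts L¹, so the product bound W(ω)e(y) on kS becomes a bound by
  -- E[W]e(y) on the L¹ norm of kh(y,·) under the law of X.
  have hle : ∀ y, ∫ u, ‖k y * h y u‖ ∂(μ.map X) ≤ (∫ ω, W ω ∂μ) * e y := by
    intro y
    calc ∫ u, ‖k y * h y u‖ ∂(μ.map X) = |k y| * ∫ ω, |h y (X ω)| ∂μ := by
          simp only [norm_mul, Real.norm_eq_abs, integral_const_mul]
          rw [integral_map hX.aemeasurable (hhy y).abs.aestronglyMeasurable]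
      _ ≤ |k y| * ∫ ω, |S y ω| ∂μ :=
          mul_le_mul_of_nonneg_left (hc y).integral_abs_le (abs_nonneg _)
      _ = ∫ ω, |k y * S y ω| ∂μ := by simp only [abs_mul, integral_const_mul]
      _ ≤ ∫ ω, W ω * e y ∂μ := integral_mono ((hc y).1.const_mul _).abs (hW.mul_const _)
          fun ω => hb ω y
      _ = _ := integral_mul_const _ _
  have hint1 : Integrable (fun z : E3 × E3 => k z.2 * h z.2 z.1) ((μ.map X).prod volume) := by
    rw [integrable_prod_iff' hm1.aestronglyMeasurable]
    refine ⟨Eventually.of_forall fun y => (hlaw y).const_mul (k y), ?_⟩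
    refine (he.const_mul (∫ ω, W ω ∂μ)).mono'
      hm1.stronglyMeasurable.norm.integral_prod_left.aestronglyMeasurable
      (Eventually.of_forall fun y => ?_)
    rw [Real.norm_of_nonneg (integral_nonneg fun _ => norm_nonneg _)]
    exact hle y
  have hint2 : Integrable (fun z : Ω × E3 => k z.2 * S z.2 z.1) (μ.prod volume) :=
    (hW.mul_prod he).mono' hm2.aestronglyMeasurable (Eventually.of_forall fun z => hb z.1 z.2)
  refine ⟨hint1.prod_right_ae, hint1.integral_prod_left, hint2.integral_prod_left, ?_⟩
  rintro φ hφ ⟨c, hφc⟩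
  have hI1 : Integrable (fun z : E3 × E3 => φ z.1 * (k z.2 * h z.2 z.1))
      ((μ.map X).prod volume) :=
    hint1.bdd_mul (c := c) (hφ.comp measurable_fst).aestronglyMeasurable
      (Eventually.of_forall fun _ => hφc _)
  have hI2 : Integrable (fun z : Ω × E3 => φ (X z.1) * (k z.2 * S z.2 z.1))
      (μ.prod volume) :=
    hint2.bdd_mul (c := c) ((hφ.comp hX).comp measurable_fst).aestronglyMeasurable
      (Eventually.of_forall fun _ => hφc _)
  simp only [← integral_const_mul]
  have s1 := integral_integral_swap (f := fun u y => φ u * (k y * h y u)) hI1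
  have s2 := integral_integral_swap (f := fun ω y => φ (X ω) * (k y * S y ω)) hI2
  rw [s1, s2]
  -- After both exchanges y is fixed, and the defining identity of the version h(y,·) applies to the
  -- bounded function φ.
  refine integral_congr_ae (Eventually.of_forall fun y => ?_)
  have e1 := (hc y).integral_mul_eq hX hφ hφc
  simp only [mul_left_comm (φ _) (k y), integral_const_mul]
  have e2 := integral_map (μ := μ) (f := fun u => φ u * h y u) hX.aemeasurable
    (hφ.mul (hhy y)).aestronglyMeasurable
  rw [e1, e2]

/-- A random velocity field at a fixed time, smooth and with a square integrable envelope. -/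
structure IsRandomSlice (μ : Measure Ω) (α : ℝ) (Z : Ω → ℝ) (v : Ω → E3 → E3) : Prop where
  measurable : ∀ y, Measurable fun ω => v ω y
  smooth : ∀ ω i, ContDiff ℝ 3 fun y => v ω y i
  memLp : MemLp Z 2 μ
  bound : ∀ ω, EnvelopeBound α (Z ω) (v ω)

namespace IsRandomSlice

variable {α : ℝ} {Z : Ω → ℝ} {v : Ω → E3 → E3}

theorem smooth_two (hv : IsRandomSlice μ α Z v) (ω : Ω) (i : Fin 3) :
    ContDiff ℝ 2 fun y => v ω y i := (hv.smooth ω i).of_le (by norm_num)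

theorem twiceDifferentiable (hv : IsRandomSlice μ α Z v) (ω : Ω) (i : Fin 3) :
    TwiceDifferentiable fun y => v ω y i := twiceDifferentiable_of_contDiff (hv.smooth_two ω i)

theorem measurable_coord (hv : IsRandomSlice μ α Z v) (y : E3) (i : Fin 3) :
    Measurable fun ω => v ω y i :=
  (EuclideanSpace.proj (𝕜 := ℝ) i).continuous.measurable.comp (hv.measurable y)

theorem measurable_pd (hv : IsRandomSlice μ α Z v) (y : E3) (i j : Fin 3) :
    Measurable fun ω => pd j (fun y => v ω y i) y :=
  TurbPDF.measurable_pd (f := fun y ω => v ω y i) (fun y => hv.measurable_coord y i)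
    fun ω => (hv.twiceDifferentiable ω i).1 y

theorem integrable_Z (hv : IsRandomSlice μ α Z v) : Integrable Z μ :=
  hv.memLp.integrable (by norm_num)

theorem integrable_Z_sq (hv : IsRandomSlice μ α Z v) : Integrable (fun ω => Z ω ^ 2) μ :=
  hv.memLp.integrable_sq

theorem memLp_coord (hv : IsRandomSlice μ α Z v) (hα : 0 ≤ α) (y : E3) (i : Fin 3) :
    MemLp (fun ω => v ω y i) 2 μ :=
  hv.memLp.mono (hv.measurable_coord y i).aestronglyMeasurable (Eventually.of_forall fun ω =>
    (((hv.bound ω).le hα y i i i).1).trans (le_abs_self _))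

theorem measurable_quadSource (hv : IsRandomSlice μ α Z v) :
    Measurable (Function.uncurry fun y ω => quadSource (v ω) y) := by
  have : (Function.uncurry fun y ω => quadSource (v ω) y) = fun z : E3 × Ω =>
      ∑ j : Fin 3, ∑ k : Fin 3, Function.uncurry
        (fun y ω => pd k (pd j (fun y' => v ω y' j * v ω y' k)) y) z := rfl
  rw [this]
  refine Finset.measurable_fun_sum _ fun j _ => Finset.measurable_fun_sum _ fun k _ => ?_
  exact measurable_uncurry_pd_pd (f := fun y ω => v ω y j * v ω y k) j k
    (fun y => (hv.measurable_coord y j).mul (hv.measurable_coord y k))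
    fun ω => (hv.twiceDifferentiable ω j).mul (hv.twiceDifferentiable ω k)

/-- `IsCondExpGiven.deriv_param` is applied twice to each product, with dominating variables 2Z² and
4Z² from the Leibniz bounds. -/
theorem condExp_quadSource (hv : IsRandomSlice μ α Z v) (hα : 0 ≤ α) (hX : Measurable X)
    {M : Fin 3 → Fin 3 → E3 → E3 → ℝ}
    (hM : ∀ j k y, IsCondExpGiven μ X (fun ω => v ω y j * v ω y k) (M j k y))
    (hMd : ∀ j k u, TwiceDifferentiable fun y => M j k y u) (y : E3) :
    IsCondExpGiven μ X (fun ω => quadSource (v ω) y)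
      (fun u => ∑ j : Fin 3, ∑ k : Fin 3, pd k (pd j (fun y' => M j k y' u)) y) := by
  refine IsCondExpGiven.sum _ (fun j _ => IsCondExpGiven.sum _ (fun k _ => ?_) hX) hX
  have hprod : ∀ ω, TwiceDifferentiable fun y' => v ω y' j * v ω y' k := fun ω =>
    (hv.twiceDifferentiable ω j).mul (hv.twiceDifferentiable ω k)
  have hle : ∀ y : E3, (1 + ‖y‖) ^ (-(2 * α)) ≤ 1 := fun y =>
    envelope_le_one (by linarith) y
  refine IsCondExpGiven.deriv_param (f := fun y ω => pd j (fun y' => v ω y' j * v ω y' k) y)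
    (g := fun y u => pd j (fun y' => M j k y' u) y) hX ?_ (hv.integrable_Z_sq.const_mul 4)
    (fun ω => (hprod ω).differentiable_pd j) (fun ω y => ?_)
    (fun u => (hMd j k u).differentiable_pd j) y
  · refine IsCondExpGiven.deriv_param hX (hM j k) (hv.integrable_Z_sq.const_mul 2)
      (fun ω => (hprod ω).1) (fun ω y => ?_) (fun u => (hMd j k u).1)
    exact (abs_pd_mul_le (hv.bound ω) (hv.twiceDifferentiable ω) j k j y).trans
      (mul_le_of_le_one_right (by positivity) (hle y))
  · exact (abs_pd_pd_mul_le (hv.bound ω) (hv.twiceDifferentiable ω) j k k j y).trans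
      (mul_le_of_le_one_right (by positivity) (hle y))

/-- The conditional expectation of the singular integral of the quadratic source. -/
theorem condExp_newton (hv : IsRandomSlice μ α Z v) (hα : 1 / 2 < α) (hX : Measurable X)
    {M : Fin 3 → Fin 3 → E3 → E3 → ℝ}
    (hM : ∀ j k y, IsCondExpGiven μ X (fun ω => v ω y j * v ω y k) (M j k y))
    (hMd : ∀ j k u, TwiceDifferentiable fun y => M j k y u) (i : Fin 3) (x : E3) :
    (∀ᵐ u ∂(μ.map X), Integrable (fun y : E3 => (y i - x i) / (4 * Real.pi * ‖y - x‖ ^ 3) *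
      ∑ j : Fin 3, ∑ k : Fin 3, pd k (pd j (fun y' => M j k y' u)) y)) ∧
    Integrable (fun u => ∫ y : E3, (y i - x i) / (4 * Real.pi * ‖y - x‖ ^ 3) *
      ∑ j : Fin 3, ∑ k : Fin 3, pd k (pd j (fun y' => M j k y' u)) y) (μ.map X) ∧
    Integrable (fun ω => ∫ y : E3, (y i - x i) / (4 * Real.pi * ‖y - x‖ ^ 3) *
      quadSource (v ω) y) μ ∧
    ∀ φ : E3 → ℝ, Measurable φ → (∃ c, ∀ u, |φ u| ≤ c) →
      ∫ ω, φ (X ω) * (∫ y : E3, (y i - x i) / (4 * Real.pi * ‖y - x‖ ^ 3) * quadSource (v ω) y) ∂μ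
        = ∫ u, φ u * (∫ y : E3, (y i - x i) / (4 * Real.pi * ‖y - x‖ ^ 3) *
      ∑ j : Fin 3, ∑ k : Fin 3, pd k (pd j (fun y' => M j k y' u)) y) ∂(μ.map X) := by
  refine condExp_integral_param (S := fun y ω => quadSource (v ω) y)
    (W := fun ω => 36 * Z ω ^ 2) (e := fun y => (‖y - x‖ ^ 2)⁻¹ * (1 + ‖y‖) ^ (-(2 * α))) hX
    (fun y => hv.condExp_quadSource (by linarith) hX hM hMd y) hv.measurable_quadSource ?_ ?_
    (hv.integrable_Z_sq.const_mul 36) (integrable_newton_envelope (by linarith) x)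
    (fun ω y => abs_kernel_mul_le i (abs_quadSource_le (hv.bound ω) (hv.twiceDifferentiable ω) y))
  · refine Finset.measurable_fun_sum _ fun j _ => Finset.measurable_fun_sum _ fun k _ => ?_
    exact measurable_uncurry_pd_pd (f := M j k) j k (fun y => (hM j k y).2.1)
      fun u => hMd j k u
  · have : Measurable fun y : E3 => y i := (contDiff_coord (n := 1) i).continuous.measurable
    fun_prop

end IsRandomSlice

end

end TurbPDF

namespace TurbPDF

/-! ### Differentiation under the integral sign -/

theorem hasDerivAt_integral_mul_of_compactSupport {Φ : E3 → ℝ} (hΦ : Continuous Φ)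
    (hc : HasCompactSupport Φ) {q q' : ℝ → E3 → ℝ} {s₀ r : ℝ} (hr : 0 < r)
    (hq : ∀ s ∈ Metric.ball s₀ r, Continuous (q s))
    (hd : ∀ u, ∀ s ∈ Metric.ball s₀ r, HasDerivAt (fun s => q s u) (q' s u) s)
    (hq' : ContinuousOn (fun z : ℝ × E3 => q' z.1 z.2) (Metric.ball s₀ r ×ˢ univ)) :
    HasDerivAt (fun s => ∫ u, Φ u * q s u) (∫ u, Φ u * q' s₀ u) s₀ := by
  -- Halving the radius yields a compact product with the support of Φ, on which the continuous q′
  -- is bounded.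
  have hsub : Metric.closedBall s₀ (r / 2) ⊆ Metric.ball s₀ r :=
    Metric.closedBall_subset_ball (by linarith)
  obtain ⟨C, hC⟩ := ((isCompact_closedBall s₀ (r / 2)).prod
    hc.isCompact).exists_bound_of_continuousOn (hq'.mono (prod_mono hsub (subset_univ _)))
  have hs₀ : s₀ ∈ Metric.ball s₀ r := Metric.mem_ball_self hr
  have hq'c : Continuous (q' s₀) := by
    have := hq'.comp_continuous (f := fun u : E3 => (s₀, u)) (by fun_prop) fun u => ⟨hs₀, trivial⟩
    exact this
  refine (hasDerivAt_integral_of_dominated_loc_of_deriv_le (μ := volume)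
    (F := fun s u => Φ u * q s u) (F' := fun s u => Φ u * q' s u) (x₀ := s₀)
    (s := Metric.closedBall s₀ (r / 2)) (bound := fun u => |Φ u| * C)
    (Metric.closedBall_mem_nhds s₀ (by linarith)) ?_ ?_ ?_ ?_ ?_ ?_).2
  · filter_upwards [Metric.ball_mem_nhds s₀ hr] with s hs
    exact (hΦ.mul (hq s hs)).aestronglyMeasurable
  · exact (hΦ.mul (hq s₀ hs₀)).integrable_of_hasCompactSupport hc.mul_right
  · exact (hΦ.mul hq'c).aestronglyMeasurable
  · refine Eventually.of_forall fun u s hs => ?_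
    by_cases hu : u ∈ tsupport Φ
    · rw [norm_mul]
      exact mul_le_mul_of_nonneg_left (hC (s, u) ⟨hs, hu⟩) (norm_nonneg _)
    · simp [image_eq_zero_of_notMem_tsupport hu]
  · exact (hΦ.integrable_of_hasCompactSupport hc).abs.mul_const _
  · exact Eventually.of_forall fun u s hs => (hd u s (hsub hs)).const_mul _

theorem exists_abs_le_of_compactSupport {Φ : E3 → ℝ} (hΦ : Continuous Φ)
    (hc : HasCompactSupport Φ) : ∃ C, ∀ u, |Φ u| ≤ C := by
  obtain ⟨C, hC⟩ := hc.exists_bound_of_continuous hΦ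
  exact ⟨C, hC⟩

section

variable {Ω : Type*} [MeasurableSpace Ω] {μ : Measure Ω} [IsProbabilityMeasure μ] {X : Ω → E3}

/-- Compact support makes every ∂ᵢF bounded, so one integrable bound on the speed of the curves
dominates the derivative given by the chain rule. -/
theorem hasDerivAt_expectation {F : E3 → ℝ} (hF : ContDiff ℝ 1 F) (hc : HasCompactSupport F)
    {γ : ℝ → Ω → E3} {γ' : ℝ → Ω → Fin 3 → ℝ} {W : Ω → ℝ} {s₀ r : ℝ} (hr : 0 < r)
    (hm : ∀ s ∈ Metric.ball s₀ r, Measurable (γ s))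
    (hd : ∀ ω i, ∀ s ∈ Metric.ball s₀ r, HasDerivAt (fun s => γ s ω i) (γ' s ω i) s)
    (hb : ∀ ω i, ∀ s ∈ Metric.ball s₀ r, |γ' s ω i| ≤ W ω) (hW : Integrable W μ) :
    Integrable (fun ω => ∑ i, pd i F (γ s₀ ω) * γ' s₀ ω i) μ ∧
    HasDerivAt (fun s => ∫ ω, F (γ s ω) ∂μ) (∫ ω, ∑ i, pd i F (γ s₀ ω) * γ' s₀ ω i ∂μ) s₀ := by
  have hFd := hF.differentiable (by simp)
  obtain ⟨C₀, hC₀⟩ := exists_abs_le_of_compactSupport hF.continuous hc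
  choose C hC using fun i : Fin 3 => exists_abs_le_of_compactSupport (continuous_pd hF (k := i))
    (hasCompactSupport_pd hc hFd)
  have hs₀ : s₀ ∈ Metric.ball s₀ r := Metric.mem_ball_self hr
  have hcomp : ∀ ω, ∀ s ∈ Metric.ball s₀ r, HasDerivAt (fun s => F (γ s ω))
      (∑ i, pd i F (γ s ω) * γ' s ω i) s := fun ω s hs =>
    hasDerivAt_comp_curve (γ := fun s => γ s ω) (hFd _) fun i => hd ω i s hs
  have hFm : ∀ s ∈ Metric.ball s₀ r, Measurable fun ω => F (γ s ω) := fun s hs =>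
    hF.continuous.measurable.comp (hm s hs)
  refine hasDerivAt_integral_of_dominated_loc_of_deriv_le (μ := μ)
    (F := fun s ω => F (γ s ω)) (F' := fun s ω => ∑ i, pd i F (γ s ω) * γ' s ω i) (x₀ := s₀)
    (s := Metric.ball s₀ r) (bound := fun ω => (∑ i, C i) * W ω)
    (Metric.ball_mem_nhds s₀ hr) ?_ ?_ ?_ ?_ (hW.const_mul _)
    (Eventually.of_forall hcomp)
  · filter_upwards [Metric.ball_mem_nhds s₀ hr] with s hs
    exact (hFm s hs).aestronglyMeasurable
  · exact Integrable.of_bound (hFm s₀ hs₀).aestronglyMeasurable C₀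
      (Eventually.of_forall fun ω => hC₀ _)
  -- Measurability of γ′ is not assumed: the chain-rule derivative is a limit of difference
  -- quotients. The steps r/(n+2) are smaller than r already at n = 0.
  · have hstep : ∀ n : ℕ, s₀ + r / ((n : ℝ) + 2) ∈ Metric.ball s₀ r := by
      intro n
      rw [Metric.mem_ball, Real.dist_eq, add_sub_cancel_left, abs_of_pos (by positivity)]
      exact div_lt_self hr (by linarith [(Nat.cast_nonneg n : (0 : ℝ) ≤ n)])
    have h0 : Tendsto (fun n : ℕ => r / ((n : ℝ) + 2)) atTop (𝓝[≠] 0) :=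
      tendsto_nhdsWithin_iff.2 ⟨tendsto_const_nhds.div_atTop
        (tendsto_atTop_add_const_right _ _ tendsto_natCast_atTop_atTop),
        Eventually.of_forall fun n => by
          have : 0 < r / ((n : ℝ) + 2) := by positivity
          exact this.ne'⟩
    refine aestronglyMeasurable_of_tendsto_ae atTop (f := fun (n : ℕ) ω =>
      (r / ((n : ℝ) + 2))⁻¹ • (F (γ (s₀ + r / ((n : ℝ) + 2)) ω) - F (γ s₀ ω))) (fun n => ?_)
      (Eventually.of_forall fun ω =>
        (hasDerivAt_iff_tendsto_slope_zero.1 (hcomp ω s₀ hs₀)).comp h0)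
    have hn : Measurable fun ω => F (γ (s₀ + r / ((n : ℝ) + 2)) ω) - F (γ s₀ ω) :=
      (hFm _ (hstep n)).sub (hFm s₀ hs₀)
    exact (hn.const_smul (r / ((n : ℝ) + 2))⁻¹).aestronglyMeasurable
  · refine Eventually.of_forall fun ω s hs => ?_
    rw [Real.norm_eq_abs, Finset.sum_mul]
    refine (Finset.abs_sum_le_sum_abs _ _).trans (Finset.sum_le_sum fun i _ => ?_)
    rw [abs_mul]
    exact mul_le_mul (hC i _) (hb ω i s hs) (abs_nonneg _) ((abs_nonneg _).trans (hC i 0))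

/-! ### Densities -/

namespace IsPDF

variable {q : E3 → ℝ}

theorem integral_law (h : IsPDF μ X q) (g : E3 → ℝ) :
    ∫ u, g u ∂(μ.map X) = ∫ u, q u * g u := by
  rw [h.2.2, integral_withDensity_eq_integral_toReal_smul h.2.1.ennreal_ofReal (by simp)]
  simp [ENNReal.toReal_ofReal (h.1 _)]

theorem integrable_law (h : IsPDF μ X q) (g : E3 → ℝ) :
    Integrable g (μ.map X) ↔ Integrable (fun u => q u * g u) := by
  rw [h.2.2, integrable_withDensity_iff_integrable_smul' h.2.1.ennreal_ofReal (by simp)]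
  simp [ENNReal.toReal_ofReal (h.1 _)]

theorem integral_comp (h : IsPDF μ X q) (hX : Measurable X) {g : E3 → ℝ} (hg : Measurable g) :
    ∫ ω, g (X ω) ∂μ = ∫ u, g u * q u := by
  rw [← integral_map hX.aemeasurable hg.aestronglyMeasurable, h.integral_law]
  simp only [mul_comm]

theorem ae_eq (h : IsPDF μ X q) {q' : E3 → ℝ} (h' : IsPDF μ X q') : q =ᵐ[volume] q' := by
  have : IsFiniteMeasure ((volume : Measure E3).withDensity fun u => ENNReal.ofReal (q u)) := by
    rw [← h.2.2]; infer_instance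
  have h1 : (volume : Measure E3).withDensity (fun u => ENNReal.ofReal (q u))
      = (volume : Measure E3).withDensity (fun u => ENNReal.ofReal (q' u)) := by
    rw [← h.2.2, ← h'.2.2]
  have h2 := (withDensity_eq_iff_of_sigmaFinite h.2.1.ennreal_ofReal.aemeasurable
    h'.2.1.ennreal_ofReal.aemeasurable).1 h1
  filter_upwards [h2] with u hu
  exact (ENNReal.ofReal_eq_ofReal_iff (h.1 u) (h'.1 u)).1 hu

end IsPDF

theorem IsCondExpGiven.integral_density {Y : Ω → ℝ} {g : E3 → ℝ} {q : E3 → ℝ}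
    (h : IsCondExpGiven μ X Y g) (hX : Measurable X) (hq : IsPDF μ X q) {φ : E3 → ℝ}
    (hφ : Continuous φ) (hc : HasCompactSupport φ) :
    Integrable (fun u => φ u * (q u * g u)) ∧
      ∫ ω, φ (X ω) * Y ω ∂μ = ∫ u, φ u * (q u * g u) := by
  obtain ⟨C, hC⟩ := exists_abs_le_of_compactSupport hφ hc
  have h1 : Integrable (fun u => q u * g u) :=
    (hq.integrable_law g).1 ((integrable_map_measure h.2.1.aestronglyMeasurable
      hX.aemeasurable).2 h.integrable_comp)
  refine ⟨h1.bdd_mul (c := C) hφ.aestronglyMeasurable (Eventually.of_forall hC), ?_⟩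
  rw [h.integral_mul_eq hX hφ.measurable hC,
    hq.integral_comp (g := fun u => φ u * g u) hX (hφ.measurable.mul h.2.1)]
  congr 1; ext u; ring

end

theorem continuous_pd_snd {f : E3 × E3 → ℝ} (hf : ContDiff ℝ 1 f) (k : Fin 3) :
    Continuous fun z : E3 × E3 => pd k (fun x => f (z.1, x)) z.2 := by
  have e : (fun z : E3 × E3 => pd k (fun x => f (z.1, x)) z.2)
      = fun z => fderiv ℝ f z (0, EuclideanSpace.single k 1) := by
    ext ⟨u, x⟩
    have h1 : HasFDerivAt (fun x : E3 => (u, x)) (ContinuousLinearMap.inr ℝ E3 E3) x :=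
      hasFDerivAt_prodMk_right u x
    have h2 := HasFDerivAt.comp (f := fun x : E3 => (u, x)) x
      (hf.differentiable (by simp) (u, x)).hasFDerivAt h1
    rw [pd_eq_fderiv (f := fun x => f (u, x)) h2.differentiableAt]
    have h3 : fderiv ℝ (fun x => f (u, x)) x = _ := h2.fderiv
    rw [h3]; simp
  rw [e]
  exact (hf.continuous_fderiv (by simp)).clm_apply continuous_const

theorem hasDerivAt_integral_space {Φ : E3 → ℝ} (hΦ : Continuous Φ) (hc : HasCompactSupport Φ)
    {f : E3 → E3 → ℝ} (hf : ∀ x, Continuous fun u => f u x)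
    (hd : ∀ u, Differentiable ℝ (f u)) (k : Fin 3)
    (hf' : Continuous fun z : E3 × E3 => pd k (f z.1) z.2) (x : E3) :
    HasDerivAt (fun s : ℝ => ∫ u, Φ u * f u (x + s • EuclideanSpace.single k 1))
      (∫ u, Φ u * pd k (f u) x) 0 := by
  have := hasDerivAt_integral_mul_of_compactSupport (s₀ := 0) (r := 1) hΦ hc
    (q := fun s u => f u (x + s • EuclideanSpace.single k 1))
    (q' := fun s u => pd k (f u) (x + s • EuclideanSpace.single k 1)) one_pos
    (fun s _ => hf _) (fun u s _ => hasDerivAt_line (hd u _)) (by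
      have h1 : Continuous fun z : ℝ × E3 =>
          (z.2, x + z.1 • (EuclideanSpace.single k 1 : E3)) := by fun_prop
      exact (hf'.comp h1).continuousOn)
  simpa using this

/-! ### Spatial derivatives of the density -/

namespace IsRandomSlice

variable {Ω : Type*} [MeasurableSpace Ω] {μ : Measure Ω} [IsProbabilityMeasure μ]
  {α : ℝ} {Z : Ω → ℝ} {v : Ω → E3 → E3} {q : E3 → E3 → ℝ}

/-- Both sides are the derivative of E[Φ(v(x))] in direction k, taken once on the density and once
along the paths. -/
theorem integral_mul_pd_density (hv : IsRandomSlice μ α Z v) (hα : 0 ≤ α)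
    (hq : ∀ x, IsPDF μ (fun ω => v ω x) fun u => q u x)
    (hqC : ContDiff ℝ 1 fun z : E3 × E3 => q z.1 z.2) {Φ : E3 → ℝ} (hΦ : ContDiff ℝ 1 Φ)
    (hc : HasCompactSupport Φ) (k : Fin 3) (x : E3) :
    ∫ u, Φ u * pd k (q u) x = ∫ ω, ∑ i, pd i Φ (v ω x) * pd k (fun y => v ω y i) x ∂μ := by
  have h1 := hasDerivAt_integral_space hΦ.continuous hc (f := q)
    (fun x => hqC.continuous.comp (f := fun u : E3 => (u, x)) (by fun_prop))
    (fun u => (hqC.comp (f := fun x : E3 => (u, x)) (by fun_prop)).differentiable (by simp)) k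
    (continuous_pd_snd hqC k) x
  have h2 := (hasDerivAt_expectation (μ := μ) hΦ hc (s₀ := 0) (r := 1) (W := Z)
    (γ := fun s ω => v ω (x + s • EuclideanSpace.single k 1))
    (γ' := fun s ω i => pd k (fun y => v ω y i) (x + s • EuclideanSpace.single k 1))
    one_pos (fun s _ => hv.measurable _)
    (fun ω i s _ => hasDerivAt_line (f := fun y => v ω y i) ((hv.twiceDifferentiable ω i).1 _))
    (fun ω i s _ => ((hv.bound ω).le hα _ i k k).2.1) hv.integrable_Z).2
  have e : (fun s : ℝ => ∫ u, Φ u * q u (x + s • EuclideanSpace.single k 1))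
      = fun s : ℝ => ∫ ω, Φ (v ω (x + s • EuclideanSpace.single k 1)) ∂μ := by
    ext s
    rw [(hq _).integral_comp (hv.measurable _) hΦ.continuous.measurable]
  rw [e] at h1
  simpa using h1.unique h2

/-- The viscous term: second derivatives of the density in terms of the conditional
expectations `b` of the velocity gradient. -/
theorem integral_mul_pd_pd_density (hv : IsRandomSlice μ α Z v) (hα : 0 ≤ α)
    (hq : ∀ x, IsPDF μ (fun ω => v ω x) fun u => q u x)
    (hqC : ContDiff ℝ 1 fun z : E3 × E3 => q z.1 z.2)
    (hqd : ∀ u, ContDiff ℝ 2 (q u)) (k : Fin 3)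
    (hq2 : Continuous fun z : E3 × E3 => pd k (pd k (q z.1)) z.2)
    {b : Fin 3 → E3 → E3 → ℝ} (hbC : ∀ i, ContDiff ℝ 1 fun z : E3 × E3 => b i z.1 z.2)
    (hb : ∀ i x, IsCondExpGiven μ (fun ω => v ω x) (fun ω => pd k (fun y => v ω y i) x)
      fun u => b i x u)
    {F : E3 → ℝ} (hF : ContDiff ℝ 2 F) (hc : HasCompactSupport F) (x : E3) :
    ∫ u, F u * pd k (pd k (q u)) x
      = ∑ i, ∫ u, pd i F u * pd k (fun x' => q u x' * b i x' u) x := by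
  have hF1 : ContDiff ℝ 1 F := hF.of_le (by norm_num)
  have hFd := hF.differentiable (by simp)
  have hFi : ∀ i, Continuous (pd i F) := fun i => continuous_pd hF1
  have hFic : ∀ i, HasCompactSupport (pd i F) := fun i => hasCompactSupport_pd hc hFd
  have hqb : ∀ i, ContDiff ℝ 1 fun z : E3 × E3 => q z.1 z.2 * b i z.2 z.1 := fun i =>
    hqC.mul ((hbC i).comp (f := fun z : E3 × E3 => (z.2, z.1)) (by fun_prop))
  have h1 := hasDerivAt_integral_space hF.continuous hc (f := fun u => pd k (q u))
    (fun x => (continuous_pd_snd hqC k).comp (f := fun u : E3 => (u, x)) (by fun_prop))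
    (fun u => (contDiff_pd (n := 1) (by simpa using hqd u)).differentiable (by simp)) k hq2 x
  have h2 := fun i => hasDerivAt_integral_space (hFi i) (hFic i)
    (f := fun u x' => q u x' * b i x' u)
    (fun x => (hqb i).continuous.comp (f := fun u : E3 => (u, x)) (by fun_prop))
    (fun u => ((hqb i).comp (f := fun x : E3 => (u, x)) (by fun_prop)).differentiable (by simp)) k
    (continuous_pd_snd (hqb i) k) x
  have h3 := HasDerivAt.fun_sum (u := Finset.univ) fun i _ => h2 i
  -- The first-order identity holds at every point of the line, conditioning each time on the
  -- velocity at that point. Hence both sides can be differentiated once more in s, and the second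
  -- derivative falls on the product of q and b.
  have e : (fun s : ℝ => ∫ u, F u * pd k (q u) (x + s • EuclideanSpace.single k 1))
      = fun s : ℝ => ∑ i, ∫ u, pd i F u * (q u (x + s • EuclideanSpace.single k 1)
          * b i (x + s • EuclideanSpace.single k 1) u) := by
    ext s
    rw [hv.integral_mul_pd_density hα hq hqC hF1 hc, integral_finsetSum]
    · exact Finset.sum_congr rfl fun i _ =>
        ((hb i _).integral_density (hv.measurable _) (hq _) (hFi i) (hFic i)).2
    · intro i _
      obtain ⟨C, hC⟩ := exists_abs_le_of_compactSupport (hFi i) (hFic i)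
      exact (hb i _).1.bdd_mul (c := C)
        ((hFi i).measurable.comp (hv.measurable _)).aestronglyMeasurable
        (Eventually.of_forall fun _ => hC _)
  rw [e] at h1
  exact h1.unique h3

end IsRandomSlice

end TurbPDF

namespace TurbPDF

/-! ### Pointwise divergence from the weak divergence -/

theorem integral_comp_smul_sub (D g : E3 → ℝ) (u₀ : E3) {a : ℝ} (ha : 0 < a) :
    ∫ u, D (a • (u - u₀)) * g u = (a ^ 3)⁻¹ * ∫ z, D z * g (u₀ + a⁻¹ • z) := by
  rw [← integral_scaled_mul (D := D) (g := fun z => g (u₀ + z)) ha,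
    ← integral_add_left_eq_self (μ := volume) (fun u => D (a • (u - u₀)) * g u) u₀]
  simp only [add_sub_cancel_left, mul_assoc, integral_const_mul]
  rw [inv_mul_cancel_left₀ (by positivity)]

theorem integrable_comp_add_smul {D g : E3 → ℝ} (hD : Continuous D) (hDc : HasCompactSupport D)
    (hg : LocallyIntegrable g) (u₀ : E3) {a : ℝ} (ha : 0 < a) :
    Integrable fun z => D z * g (u₀ + a⁻¹ • z) := by
  have hc : Continuous fun u : E3 => D (a • (u - u₀)) := hD.comp (by fun_prop)
  have hcs : HasCompactSupport fun u : E3 => D (a • (u - u₀)) := by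
    have := hDc.comp_homeomorph
      ((Homeomorph.subRight u₀).trans (Homeomorph.smulOfNeZero a ha.ne'))
    exact this
  have h1 := hg.integrable_smul_left_of_hasCompactSupport hc hcs
  have h2 := (h1.comp_add_left u₀).comp_smul (inv_ne_zero ha.ne')
  simpa [smul_smul, ha.ne'] using h2

/-- On the bounded support of D the points z/a tend uniformly to 0, so a|R(z/a)| is at most any
prescribed multiple of |z| once a is large. -/
theorem tendsto_integral_remainder {D R : E3 → ℝ} (hD : Continuous D)
    (hDc : HasCompactSupport D) (hR : R =o[𝓝 0] fun w => w) {a : ℕ → ℝ} (ha0 : ∀ n, 0 < a n)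
    (ha : Tendsto a atTop atTop) :
    Tendsto (fun n => ∫ z, D z * (a n * R ((a n)⁻¹ • z))) atTop (𝓝 0) := by
  obtain ⟨ρ, hρ⟩ := hDc.isCompact.isBounded.subset_closedBall (0 : E3)
  set K := ∫ z, |D z| * ‖z‖ with hK
  have hKint : Integrable fun z => |D z| * ‖z‖ :=
    (hD.abs.mul continuous_norm).integrable_of_hasCompactSupport hDc.abs.mul_right
  have hK0 : 0 ≤ K := integral_nonneg fun z => by positivity
  rw [Metric.tendsto_nhds]
  intro ε hε
  have hc : 0 < ε / (K + 1) := by positivity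
  obtain ⟨δ, hδ, hball⟩ := Metric.eventually_nhds_iff.1 (hR.bound hc)
  have hinv : Tendsto (fun n => (a n)⁻¹ * ρ) atTop (𝓝 0) := by
    simpa using (tendsto_inv_atTop_zero.comp ha).mul_const ρ
  filter_upwards [hinv.eventually_lt_const hδ] with n hn
  rw [dist_zero_right]
  have hle : ‖∫ z, D z * (a n * R ((a n)⁻¹ • z))‖ ≤ ∫ z, ε / (K + 1) * (|D z| * ‖z‖) := by
    refine norm_integral_le_of_norm_le (hKint.const_mul _) (Eventually.of_forall fun z => ?_)
    by_cases hz : z ∈ tsupport D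
    · have h1 : ‖z‖ ≤ ρ := by simpa using hρ hz
      have hai : 0 < (a n)⁻¹ := inv_pos.2 (ha0 n)
      have h2 : ‖(a n)⁻¹ • z‖ = (a n)⁻¹ * ‖z‖ := by
        rw [norm_smul, Real.norm_of_nonneg hai.le]
      have h3 := hball (y := (a n)⁻¹ • z) (by
        rw [dist_zero_right, h2]
        exact (mul_le_mul_of_nonneg_left h1 hai.le).trans_lt hn)
      rw [h2] at h3
      rw [norm_mul, norm_mul, Real.norm_of_nonneg (ha0 n).le, Real.norm_eq_abs (D z)]
      calc |D z| * (a n * ‖R ((a n)⁻¹ • z)‖)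
          ≤ |D z| * (a n * (ε / (K + 1) * ((a n)⁻¹ * ‖z‖))) := by
            have := (ha0 n).le
            gcongr
        _ = ε / (K + 1) * (|D z| * ‖z‖) := by
            have := (ha0 n).ne'
            field_simp
    · simp [image_eq_zero_of_notMem_tsupport hz]
  rw [integral_const_mul, ← hK] at hle
  refine hle.trans_lt ?_
  rw [div_mul_eq_mul_div, div_lt_iff₀ (by positivity)]
  nlinarith

/-- The equation is tested against φ(a(u − u₀)) for a normalized bump φ. As a → ∞ the left side
tends to T(u₀). The derivative of the test function produces a factor a, exactly balanced by the
first-order Taylor expansion of G at u₀, so differentiability at that single point suffices. -/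
theorem eq_divergence_of_weak {T : E3 → ℝ} {G : Fin 3 → E3 → ℝ} (hT : Continuous T)
    (hG : ∀ i, LocallyIntegrable (G i))
    (hw : ∀ F : E3 → ℝ, ContDiff ℝ (⊤ : ℕ∞) F → HasCompactSupport F →
      ∫ u, F u * T u = - ∫ u, ∑ i : Fin 3, pd i F u * G i u)
    {u₀ : E3} (hd : ∀ i, DifferentiableAt ℝ (G i) u₀) : T u₀ = ∑ i : Fin 3, pd i (G i) u₀ := by
  let f : ContDiffBump (0 : E3) := ⟨1, 2, one_pos, one_lt_two⟩
  set φ : E3 → ℝ := f.normed volume with hφdef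
  have hφ : ContDiff ℝ (⊤ : ℕ∞) φ := f.contDiff_normed
  have hφ1 : ContDiff ℝ 1 φ := f.contDiff_normed
  have hφd : Differentiable ℝ φ := hφ1.differentiable (by simp)
  have hφc : HasCompactSupport φ := f.hasCompactSupport_normed
  have hφI : ∫ z, φ z = 1 := f.integral_normed
  have hpc : ∀ i, Continuous (pd i φ) := fun i => continuous_pd hφ1
  have hpcs : ∀ i, HasCompactSupport (pd i φ) := fun i => hasCompactSupport_pd hφc hφd
  set a : ℕ → ℝ := fun n => (n : ℝ) + 1 with hadef
  have ha0 : ∀ n, 0 < a n := fun n => by positivity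
  have hat : Tendsto a atTop atTop :=
    tendsto_atTop_add_const_right _ _ tendsto_natCast_atTop_atTop
  set R : Fin 3 → E3 → ℝ := fun i w => G i (u₀ + w) - G i u₀ - fderiv ℝ (G i) u₀ w with hRdef
  have hR : ∀ i, R i =o[𝓝 0] fun w => w := fun i =>
    hasFDerivAt_iff_isLittleO_nhds_zero.1 (hd i).hasFDerivAt
  have scaled : ∀ n, ∫ z, φ z * T (u₀ + (a n)⁻¹ • z)
      = - ∑ i : Fin 3, ∫ z, pd i φ z * (a n * G i (u₀ + (a n)⁻¹ • z)) := by
    intro n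
    have hcd : ContDiff ℝ (⊤ : ℕ∞) fun u : E3 => φ (a n • (u - u₀)) :=
      hφ.comp (by fun_prop)
    have hcs : ∀ {ψ : E3 → ℝ}, HasCompactSupport ψ →
        HasCompactSupport fun u : E3 => ψ (a n • (u - u₀)) := fun hψ =>
      hψ.comp_homeomorph ((Homeomorph.subRight u₀).trans (Homeomorph.smulOfNeZero _ (ha0 n).ne'))
    have hp : ∀ i u, pd i (fun u : E3 => φ (a n • (u - u₀))) u
        = a n * pd i φ (a n • (u - u₀)) := by
      intro i u
      have := pd_comp_smul hφd (a n) i (u - u₀)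
      rw [← this]
      simp only [pd, lineDeriv, add_sub_right_comm]
    have h1 := hw _ hcd (hcs hφc)
    rw [integral_comp_smul_sub φ T u₀ (ha0 n)] at h1
    have h2 : ∫ u, ∑ i : Fin 3, pd i (fun u : E3 => φ (a n • (u - u₀))) u * G i u
        = ∑ i : Fin 3, (a n ^ 3)⁻¹ * ∫ z, pd i φ z * (a n * G i (u₀ + (a n)⁻¹ • z)) := by
      rw [integral_finsetSum]
      · refine Finset.sum_congr rfl fun i _ => ?_
        rw [← integral_comp_smul_sub (pd i φ) (fun u => a n * G i u) u₀ (ha0 n)]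
        congr 1; ext u
        rw [hp]; ring
      · intro i _
        simp only [hp, mul_assoc]
        have hc : Continuous fun u : E3 => pd i φ (a n • (u - u₀)) := (hpc i).comp (by fun_prop)
        exact ((hG i).integrable_smul_left_of_hasCompactSupport hc (hcs (hpcs i))).const_mul _
    rw [h2, ← Finset.mul_sum, ← mul_neg] at h1
    exact mul_left_cancel₀ (inv_ne_zero (pow_ne_zero 3 (ha0 n).ne')) h1
  -- Integration by parts is legitimate for the affine part, whose scaled derivative is the constant
  -- ∂ᵢGⁱ(u₀); the value of G at u₀ drops out.
  have affine : ∀ n i, ∫ z, pd i φ z * (a n * (G i u₀ + fderiv ℝ (G i) u₀ ((a n)⁻¹ • z)))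
      = - pd i (G i) u₀ := by
    intro n i
    have hl : ContDiff ℝ 1 fun z : E3 => a n * (G i u₀ + fderiv ℝ (G i) u₀ ((a n)⁻¹ • z)) :=
      contDiff_const.mul (contDiff_const.add
        ((fderiv ℝ (G i) u₀).contDiff.comp (contDiff_const_smul _)))
    have h1 := integral_mul_pd (k := i) hφ1 hl hφc
    have h2 : ∀ z, pd i (fun z : E3 => a n * (G i u₀ + fderiv ℝ (G i) u₀ ((a n)⁻¹ • z))) z
        = pd i (G i) u₀ := by
      intro z
      rw [pd_eq_fderiv (hd i)]
      apply pd_eq_of_hasDerivAt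
      have h3 := ((((fderiv ℝ (G i) u₀).hasFDerivAt.comp_hasDerivAt (0 : ℝ)
        ((((hasDerivAt_id (0 : ℝ)).smul_const (EuclideanSpace.single i 1 : E3)).const_add
          z).const_smul (a n)⁻¹)).const_add (G i u₀)).const_mul (a n))
      convert! h3 using 1
      simp [(ha0 n).ne']
    simp only [h2, integral_mul_const, hφI, one_mul] at h1
    linarith
  have key : ∀ n, ∫ z, φ z * T (u₀ + (a n)⁻¹ • z)
      = ∑ i : Fin 3, pd i (G i) u₀
        - ∑ i : Fin 3, ∫ z, pd i φ z * (a n * R i ((a n)⁻¹ • z)) := by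
    intro n
    rw [scaled, ← Finset.sum_neg_distrib, ← Finset.sum_sub_distrib]
    refine Finset.sum_congr rfl fun i _ => ?_
    have hI1 : Integrable fun z => pd i φ z * (a n * G i (u₀ + (a n)⁻¹ • z)) := by
      simpa only [mul_left_comm] using
        (integrable_comp_add_smul (hpc i) (hpcs i) (hG i) u₀ (ha0 n)).const_mul (a n)
    have hI2 : Integrable fun z =>
        pd i φ z * (a n * (G i u₀ + fderiv ℝ (G i) u₀ ((a n)⁻¹ • z))) := by
      refine Continuous.integrable_of_hasCompactSupport ?_ (hpcs i).mul_right
      exact (hpc i).mul (continuous_const.mul (continuous_const.add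
        ((fderiv ℝ (G i) u₀).continuous.comp (continuous_const_smul _))))
    have hs : ∫ z, pd i φ z * (a n * R i ((a n)⁻¹ • z))
        = (∫ z, pd i φ z * (a n * G i (u₀ + (a n)⁻¹ • z)))
          - ∫ z, pd i φ z * (a n * (G i u₀ + fderiv ℝ (G i) u₀ ((a n)⁻¹ • z))) := by
      rw [← integral_sub hI1 hI2]
      congr 1; ext z
      simp only [hRdef]; ring
    rw [hs, affine]; ring
  have lim1 : Tendsto (fun n => ∫ z, φ z * T (u₀ + (a n)⁻¹ • z)) atTop (𝓝 (T u₀)) := by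
    have := tendsto_mollified (g := fun w => T (u₀ + w)) hφ.continuous hφc
      (hT.comp (continuous_const.add continuous_id)) (tendsto_inv_atTop_zero.comp hat) fun n => by
        simp only [Function.comp]
        rw [abs_of_pos (inv_pos.2 (ha0 n))]
        exact inv_le_one_of_one_le₀ (by simp [hadef])
    simpa [hφI] using this
  have lim2 : Tendsto (fun n => ∫ z, φ z * T (u₀ + (a n)⁻¹ • z)) atTop
      (𝓝 (∑ i : Fin 3, pd i (G i) u₀)) := by
    simp only [key]
    have h3 := tendsto_finsetSum (Finset.univ : Finset (Fin 3)) fun i _ =>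
      tendsto_integral_remainder (hpc i) (hpcs i) (hR i) ha0 hat
    simpa using h3.const_sub (∑ i : Fin 3, pd i (G i) u₀)
  exact tendsto_nhds_unique lim1 lim2

end TurbPDF

namespace TurbPDF

/-! ### The weak form of the equation at a fixed point -/

namespace IsRandomSlice

variable {Ω : Type*} [MeasurableSpace Ω] {μ : Measure Ω} [IsProbabilityMeasure μ]
  {α : ℝ} {Z : Ω → ℝ} {v : Ω → E3 → E3} {q : E3 → E3 → ℝ}

/-- Mass and momentum balance combined: transport of the density against the forces. -/
theorem integral_transport (hv : IsRandomSlice μ α Z v) (hα : 0 ≤ α)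
    (hq : ∀ x, IsPDF μ (fun ω => v ω x) fun u => q u x)
    (hqC : ContDiff ℝ 1 fun z : E3 × E3 => q z.1 z.2) {x : E3} {f dt : Ω → Fin 3 → ℝ}
    (hdiv : ∀ ω, ∑ j : Fin 3, pd j (fun y => v ω y j) x = 0)
    (hmom : ∀ ω i, dt ω i + ∑ j : Fin 3, v ω x j * pd j (fun y => v ω y i) x = f ω i)
    {a F : E3 → ℝ} (hF : ContDiff ℝ 1 F) (hc : HasCompactSupport F)
    (hdtI : Integrable (fun ω => ∑ i, pd i F (v ω x) * dt ω i) μ)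
    (hdt : ∫ u, F u * a u = ∫ ω, ∑ i, pd i F (v ω x) * dt ω i ∂μ) :
    (∫ u, F u * a u) + ∑ k : Fin 3, ∫ u, F u * (u k * pd k (q u) x)
      = ∫ ω, ∑ i, pd i F (v ω x) * f ω i ∂μ := by
  have hFd := hF.differentiable (by simp)
  have hΦ : ∀ k : Fin 3, ContDiff ℝ 1 fun u : E3 => F u * u k := fun k => hF.mul (contDiff_coord k)
  have hΦc : ∀ k : Fin 3, HasCompactSupport fun u : E3 => F u * u k := fun k => hc.mul_right
  have hk : ∀ k : Fin 3, ∫ u, F u * (u k * pd k (q u) x)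
      = ∫ ω, ∑ i, pd i (fun u : E3 => F u * u k) (v ω x) * pd k (fun y => v ω y i) x ∂μ := by
    intro k
    rw [← hv.integral_mul_pd_density hα hq hqC (hΦ k) (hΦc k)]
    simp only [mul_assoc]
  have hI : ∀ k ∈ (Finset.univ : Finset (Fin 3)), Integrable (fun ω =>
      ∑ i, pd i (fun u : E3 => F u * u k) (v ω x) * pd k (fun y => v ω y i) x) μ := by
    intro k _
    refine integrable_finsetSum _ fun i _ => ?_
    have hcont : Continuous (pd i fun u : E3 => F u * u k) := continuous_pd (hΦ k)
    obtain ⟨C, hC⟩ := exists_abs_le_of_compactSupport hcont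
      (hasCompactSupport_pd (hΦc k) ((hΦ k).differentiable (by simp)))
    refine Integrable.bdd_mul (c := C) (hv.integrable_Z.mono' (hv.measurable_pd x i k).aestronglyMeasurable
      (Eventually.of_forall fun ω => ((hv.bound ω).le hα x i k k).2.1))
      (hcont.measurable.comp (hv.measurable x)).aestronglyMeasurable
      (Eventually.of_forall fun _ => hC _)
  rw [hdt, Finset.sum_congr rfl fun k _ => hk k, ← integral_finsetSum _ hI,
    ← integral_add hdtI (integrable_finsetSum _ hI)]
  congr 1; ext ω
  -- The Kronecker term, summed over i and k, multiplies F by div v, which vanishes. The other term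
  -- reassembles the convection v·∇vⁱ.
  have hp : ∀ i k : Fin 3, pd i (fun u : E3 => F u * u k) (v ω x)
      = F (v ω x) * (if k = i then 1 else 0) + pd i F (v ω x) * v ω x k := fun i k => by
    rw [pd_mul (hFd _) (differentiable_coord k _), pd_coord]
  have hd := hdiv ω
  simp only [hp, ← hmom, Fin.sum_univ_three] at hd ⊢
  simp
  linear_combination F (v ω x) * hd

/-- The weak equation in terms of the conditional expectations `b` of the velocity gradient, `A`
of the Laplacian and `Q` of the pressure gradient. -/
theorem weak_equation (hv : IsRandomSlice μ α Z v) (hα : 0 ≤ α) {ν : ℝ}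
    (hq : ∀ x, IsPDF μ (fun ω => v ω x) fun u => q u x)
    (hqC : ContDiff ℝ 1 fun z : E3 × E3 => q z.1 z.2) (hqd : ∀ u, ContDiff ℝ 2 (q u))
    (hq2 : ∀ k, Continuous fun z : E3 × E3 => pd k (pd k (q z.1)) z.2)
    {b : Fin 3 → Fin 3 → E3 → E3 → ℝ}
    (hbC : ∀ i k, ContDiff ℝ 1 fun z : E3 × E3 => b i k z.1 z.2)
    (hb : ∀ i k x, IsCondExpGiven μ (fun ω => v ω x) (fun ω => pd k (fun y => v ω y i) x)
      fun u => b i k x u) {x : E3} {A Q : Fin 3 → E3 → ℝ}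
    (hA : ∀ i, IsCondExpGiven μ (fun ω => v ω x) (fun ω => lap (fun y => v ω y i) x) (A i))
    {dt gP : Ω → Fin 3 → ℝ} (hgP : ∀ i, Integrable (fun ω => gP ω i) μ)
    (hQ : ∀ i, Integrable (Q i) (μ.map fun ω => v ω x))
    (hgQ : ∀ i, ∀ φ : E3 → ℝ, Measurable φ → (∃ c, ∀ u, |φ u| ≤ c) →
      ∫ ω, φ (v ω x) * gP ω i ∂μ = ∫ u, φ u * Q i u ∂(μ.map fun ω => v ω x))
    (hdiv : ∀ ω, ∑ j : Fin 3, pd j (fun y => v ω y j) x = 0)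
    (hmom : ∀ ω i, dt ω i + ∑ j : Fin 3, v ω x j * pd j (fun y => v ω y i) x
      = ν * lap (fun y => v ω y i) x - gP ω i)
    {a F : E3 → ℝ} (ha : Continuous a) (hF : ContDiff ℝ 2 F) (hc : HasCompactSupport F)
    (hdtI : Integrable (fun ω => ∑ i, pd i F (v ω x) * dt ω i) μ)
    (hdt : ∫ u, F u * a u = ∫ ω, ∑ i, pd i F (v ω x) * dt ω i ∂μ) :
    ∫ u, F u * (a u + ∑ i : Fin 3, u i * pd i (q u) x - ν * lap (q u) x)
      = - ∫ u, ∑ i : Fin 3, pd i F u * (ν * ∑ k : Fin 3, pd k (fun x' => q u x' * b i k x' u) x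
          - ν * q u x * A i u + q u x * Q i u) := by
  have hF1 : ContDiff ℝ 1 F := hF.of_le (by norm_num)
  have hFi : ∀ i, Continuous (pd i F) := fun i => continuous_pd hF1
  have hFic : ∀ i, HasCompactSupport (pd i F) := fun i =>
    hasCompactSupport_pd hc (hF.differentiable (by simp))
  have hX := hv.measurable x
  have cint : ∀ {g h : E3 → ℝ}, Continuous g → HasCompactSupport g → Continuous h →
      Integrable fun u => g u * h u := fun hg hgc hh =>
    (hg.mul hh).integrable_of_hasCompactSupport hgc.mul_right
  have slice : ∀ {f : E3 × E3 → ℝ}, Continuous f → Continuous fun u => f (u, x) :=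
    fun hf => hf.comp (by fun_prop)
  have hqb : ∀ i k, ContDiff ℝ 1 fun z : E3 × E3 => q z.1 z.2 * b i k z.2 z.1 := fun i k =>
    hqC.mul ((hbC i k).comp (f := fun z : E3 × E3 => (z.2, z.1)) (by fun_prop))
  have c1 : ∀ k : Fin 3, Continuous fun u : E3 => u k * pd k (q u) x := fun k =>
    (contDiff_coord (n := 1) k).continuous.mul (slice (continuous_pd_snd hqC k))
  have c2 : ∀ k : Fin 3, Continuous fun u : E3 => pd k (pd k (q u)) x := fun k => slice (hq2 k)
  have c3 : ∀ i k : Fin 3, Continuous fun u : E3 => pd k (fun x' => q u x' * b i k x' u) x :=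
    fun i k => slice (continuous_pd_snd (hqb i k) k)
  have left : ∫ u, F u * (a u + ∑ i : Fin 3, u i * pd i (q u) x - ν * lap (q u) x)
      = (∫ u, F u * a u) + (∑ k : Fin 3, ∫ u, F u * (u k * pd k (q u) x))
        - ν * ∑ k : Fin 3, ∫ u, F u * pd k (pd k (q u)) x := by
    have i1 := cint hF.continuous hc ha
    have i2 := fun k => cint hF.continuous hc (c1 k)
    have i3 := fun k => cint hF.continuous hc (c2 k)
    have i4 : Integrable fun u => F u * a u + ∑ k : Fin 3, F u * (u k * pd k (q u) x) :=
      i1.add (integrable_finsetSum _ fun k _ => i2 k)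
    rw [← integral_finsetSum _ fun k _ => i2 k, ← integral_finsetSum _ fun k _ => i3 k,
      ← integral_const_mul, ← integral_add i1 (integrable_finsetSum _ fun k _ => i2 k),
      ← integral_sub i4
        ((integrable_finsetSum _ fun k _ => i3 k).const_mul ν)]
    congr 1; ext u
    simp only [lap, ← Finset.mul_sum]
    ring
  have hAd := fun i => (hA i).integral_density hX (hq x) (hFi i) (hFic i)
  have hQd : ∀ i, Integrable (fun u => pd i F u * (q u x * Q i u)) ∧
      ∫ ω, pd i F (v ω x) * gP ω i ∂μ = ∫ u, pd i F u * (q u x * Q i u) := by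
    intro i
    obtain ⟨C, hC⟩ := exists_abs_le_of_compactSupport (hFi i) (hFic i)
    refine ⟨((((hq x).integrable_law _).1 (hQ i))).bdd_mul (c := C) (hFi i).aestronglyMeasurable
      (Eventually.of_forall hC), ?_⟩
    rw [hgQ i _ (hFi i).measurable ⟨C, hC⟩, (hq x).integral_law]
    congr 1; ext u; ring
  -- Here the conditional expectations enter: ∂ᵢF(v(x)) is a bounded function of the conditioning
  -- variable, so the forces may be replaced by A and Q.
  have force : ∫ ω, ∑ i, pd i F (v ω x) * (ν * lap (fun y => v ω y i) x - gP ω i) ∂μ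
      = ∑ i, (ν * (∫ u, pd i F u * (q u x * A i u)) - ∫ u, pd i F u * (q u x * Q i u)) := by
    have j1 : ∀ i, Integrable (fun ω => pd i F (v ω x) * lap (fun y => v ω y i) x) μ := fun i => by
      obtain ⟨C, hC⟩ := exists_abs_le_of_compactSupport (hFi i) (hFic i)
      exact (hA i).1.bdd_mul (c := C) ((hFi i).measurable.comp hX).aestronglyMeasurable
        (Eventually.of_forall fun _ => hC _)
    have j2 : ∀ i, Integrable (fun ω => pd i F (v ω x) * gP ω i) μ := fun i => by
      obtain ⟨C, hC⟩ := exists_abs_le_of_compactSupport (hFi i) (hFic i)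
      exact (hgP i).bdd_mul (c := C) ((hFi i).measurable.comp hX).aestronglyMeasurable
        (Eventually.of_forall fun _ => hC _)
    simp only [mul_sub, mul_left_comm _ ν]
    have j3 : ∀ i, Integrable (fun ω => ν * (pd i F (v ω x) * lap (fun y => v ω y i) x)
        - pd i F (v ω x) * gP ω i) μ := fun i => ((j1 i).const_mul ν).sub (j2 i)
    rw [integral_finsetSum _ fun i _ => j3 i]
    refine Finset.sum_congr rfl fun i _ => ?_
    rw [integral_sub ((j1 i).const_mul ν) (j2 i), integral_const_mul, (hAd i).2, (hQd i).2]
  have right : ∫ u, ∑ i : Fin 3, pd i F u *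
        (ν * ∑ k : Fin 3, pd k (fun x' => q u x' * b i k x' u) x
          - ν * q u x * A i u + q u x * Q i u)
      = ∑ i : Fin 3, (ν * (∑ k : Fin 3, ∫ u, pd i F u * pd k (fun x' => q u x' * b i k x' u) x)
          - ν * (∫ u, pd i F u * (q u x * A i u)) + ∫ u, pd i F u * (q u x * Q i u)) := by
    have i1 := fun i k => cint (hFi i) (hFic i) (c3 i k)
    have i2 := fun i => integrable_finsetSum Finset.univ fun k _ => i1 i k
    have e : ∀ i u, pd i F u * (ν * ∑ k : Fin 3, pd k (fun x' => q u x' * b i k x' u) x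
          - ν * q u x * A i u + q u x * Q i u)
        = ν * (∑ k : Fin 3, pd i F u * pd k (fun x' => q u x' * b i k x' u) x)
          - ν * (pd i F u * (q u x * A i u)) + pd i F u * (q u x * Q i u) := by
      intro i u; rw [← Finset.mul_sum]; ring
    simp only [e]
    have i5 : ∀ i, Integrable fun u =>
        ν * (∑ k : Fin 3, pd i F u * pd k (fun x' => q u x' * b i k x' u) x)
          - ν * (pd i F u * (q u x * A i u)) := fun i =>
      ((i2 i).const_mul ν).sub ((hAd i).1.const_mul ν)
    have i6 : ∀ i, Integrable fun u =>
        ν * (∑ k : Fin 3, pd i F u * pd k (fun x' => q u x' * b i k x' u) x)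
          - ν * (pd i F u * (q u x * A i u)) + pd i F u * (q u x * Q i u) := fun i =>
      (i5 i).add (hQd i).1
    rw [integral_finsetSum _ fun i _ => i6 i]
    refine Finset.sum_congr rfl fun i _ => ?_
    rw [integral_add (i5 i) (hQd i).1,
      integral_sub ((i2 i).const_mul ν) ((hAd i).1.const_mul ν), integral_const_mul,
      integral_const_mul, integral_finsetSum _ fun k _ => i1 i k]
  rw [left, right, hv.integral_transport hα hq hqC hdiv hmom hF1 hc hdtI hdt, force,
    Finset.sum_congr rfl fun k _ => hv.integral_mul_pd_pd_density hα hq hqC hqd k (hq2 k)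
      (fun i => hbC i k) (fun i x => hb i k x) hF hc x, Finset.sum_comm]
  simp only [Finset.sum_add_distrib, Finset.sum_sub_distrib, Finset.mul_sum]
  ring

/-- The flux is locally integrable. -/
theorem locallyIntegrable_flux (hv : IsRandomSlice μ α Z v) {ν : ℝ} {x : E3}
    (hq : IsPDF μ (fun ω => v ω x) fun u => q u x)
    (hqC : ContDiff ℝ 1 fun z : E3 × E3 => q z.1 z.2)
    {b : Fin 3 → E3 → E3 → ℝ} (hbC : ∀ k, ContDiff ℝ 1 fun z : E3 × E3 => b k z.1 z.2)
    {A Q : E3 → ℝ} {Y : Ω → ℝ} (hA : IsCondExpGiven μ (fun ω => v ω x) Y A)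
    (hQ : Integrable Q (μ.map fun ω => v ω x)) :
    LocallyIntegrable fun u => ν * ∑ k : Fin 3, pd k (fun x' => q u x' * b k x' u) x
      - ν * q u x * A u + q u x * Q u := by
  have hqb : ∀ k, ContDiff ℝ 1 fun z : E3 × E3 => q z.1 z.2 * b k z.2 z.1 := fun k =>
    hqC.mul ((hbC k).comp (f := fun z : E3 × E3 => (z.2, z.1)) (by fun_prop))
  have c3 : Continuous fun u : E3 => ν * ∑ k : Fin 3, pd k (fun x' => q u x' * b k x' u) x :=
    continuous_const.mul (continuous_finsetSum _ fun k _ =>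
      (continuous_pd_snd (hqb k) k).comp (f := fun u : E3 => (u, x)) (by fun_prop))
  -- A and Q are integrable under the law of v(x), so their products with the density are integrable
  -- over the whole space; the remaining term is continuous.
  have hAl : Integrable fun u => q u x * A u := (hq.integrable_law _).1
    ((integrable_map_measure hA.2.1.aestronglyMeasurable (hv.measurable x).aemeasurable).2
      hA.integrable_comp)
  have hQl : Integrable fun u => q u x * Q u := (hq.integrable_law _).1 hQ
  have := (c3.locallyIntegrable (μ := volume)).sub (hAl.const_mul ν).locallyIntegrable
  simp only [mul_assoc] at this ⊢
  exact this.add hQl.locallyIntegrable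

end IsRandomSlice

end TurbPDF

namespace TurbPDF

/-! ### Regularity of the density at a fixed time -/

namespace IsC121

variable {p : E3 → E3 → ℝ → ℝ}

theorem contDiff_slice (h : IsC121 p) {t : ℝ} (ht : 0 < t) :
    ContDiff ℝ 1 fun z : E3 × E3 => p z.1 z.2 t := by
  rw [← contDiffOn_univ]
  exact h.first.comp (f := fun z : E3 × E3 => (z.1, z.2, t))
    (ContDiff.contDiffOn (by fun_prop)) fun z _ => ⟨trivial, trivial, ht⟩

theorem continuous_pd_pd (h : IsC121 p) {t : ℝ} (ht : 0 < t) (j k : Fin 3) :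
    Continuous fun z : E3 × E3 => pd j (pd k fun x => p z.1 x t) z.2 :=
  (h.second_continuous j k).comp_continuous (f := fun z : E3 × E3 => (z.1, z.2, t))
    (by fun_prop) fun z => ⟨trivial, trivial, ht⟩

theorem isOpen_domain : IsOpen (univ ×ˢ univ ×ˢ Ioi 0 : Set (E3 × E3 × ℝ)) :=
  isOpen_univ.prod (isOpen_univ.prod isOpen_Ioi)

theorem hasDerivAt_time (h : IsC121 p) (u x : E3) {t : ℝ} (ht : 0 < t) :
    HasDerivAt (fun s => p u x s)
      (fderiv ℝ (fun z : E3 × E3 × ℝ => p z.1 z.2.1 z.2.2) (u, x, t) (0, 0, 1)) t := by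
  have h1 := (h.first.contDiffAt (isOpen_domain.mem_nhds
    (show (u, x, t) ∈ univ ×ˢ univ ×ˢ Ioi (0 : ℝ) from
      ⟨trivial, trivial, ht⟩))).differentiableAt (by simp)
  have h2 : HasDerivAt (fun s : ℝ => (u, x, s)) ((0 : E3), (0 : E3), (1 : ℝ)) t :=
    (hasDerivAt_const t u).prodMk ((hasDerivAt_const t x).prodMk (hasDerivAt_id t))
  exact h1.hasFDerivAt.comp_hasDerivAt t h2

theorem continuousOn_deriv_time (h : IsC121 p) (x : E3) :
    ContinuousOn (fun z : ℝ × E3 => deriv (fun s => p z.2 x s) z.1) (Ioi 0 ×ˢ univ) := by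
  have h1 : ContinuousOn (fun z : E3 × E3 × ℝ =>
      fderiv ℝ (fun z : E3 × E3 × ℝ => p z.1 z.2.1 z.2.2) z (0, 0, 1))
      (univ ×ˢ univ ×ˢ Ioi 0) :=
    (h.first.continuousOn_fderiv_of_isOpen isOpen_domain (by simp)).clm_apply continuousOn_const
  have h2 := h1.comp (f := fun z : ℝ × E3 => (z.2, x, z.1)) (s := Ioi 0 ×ˢ univ)
    (by fun_prop) fun z hz => ⟨trivial, trivial, hz.1⟩
  exact h2.congr fun z hz => (h.hasDerivAt_time z.2 x hz.1).deriv

theorem continuous_deriv_time (h : IsC121 p) (x : E3) {t : ℝ} (ht : 0 < t) :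
    Continuous fun u => deriv (fun s => p u x s) t :=
  (h.continuousOn_deriv_time x).comp_continuous (f := fun u : E3 => (t, u)) (by fun_prop)
    fun _ => ⟨ht, trivial⟩

theorem continuous_transportPart (h : IsC121 p) (ν : ℝ) (x : E3) {t : ℝ} (ht : 0 < t) :
    Continuous fun u => transportPart ν p u x t := by
  have slice : ∀ {f : E3 × E3 → ℝ}, Continuous f → Continuous fun u => f (u, x) :=
    fun hf => hf.comp (by fun_prop)
  unfold transportPart lap
  refine ((h.continuous_deriv_time x ht).add (continuous_finsetSum _ fun i _ => ?_)).sub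
    (continuous_const.mul (continuous_finsetSum _ fun k _ => slice (h.continuous_pd_pd ht k k)))
  exact (contDiff_coord (n := 1) i).continuous.mul
    (slice (continuous_pd_snd (h.contDiff_slice ht) i))

end IsC121

/-! ### The random field: time derivative, conditional versions, initial data -/

section

variable {Ω : Type*} [MeasurableSpace Ω] {μ : Measure Ω} [IsProbabilityMeasure μ]
  {ν α : ℝ} {U : E3 → ℝ → Ω → E3} {Pr : E3 → ℝ → Ω → ℝ} {U₀ : E3 → Ω → E3}
  {ρ : E3 → E3 → E3 → ℝ → E3} {σ : E3 → E3 → E3 → ℝ → Fin 3 → Fin 3 → ℝ}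
  {p : E3 → E3 → ℝ → ℝ}

/-- A single Z serves the whole time interval, as dominated differentiation in t requires. -/
theorem isRandomSlice_of_envelope (hU : ∀ x t, 0 ≤ t → Measurable (U x t))
    (hsmooth : ∀ ω, SmoothDecaying (fun x t => U x t ω) (fun x t => Pr x t ω))
    (henv : HasDecayEnvelope μ α U) {a b : ℝ} (ha : 0 < a) (hab : a ≤ b) :
    ∃ Z : Ω → ℝ, ∀ t ∈ Icc a b, IsRandomSlice μ α Z fun ω y => U y t ω := by
  obtain ⟨Z, hZ, hb⟩ := henv a b ha hab
  exact ⟨Z, fun t ht => ⟨fun y => hU y t (ha.le.trans ht.1),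
    fun ω i => (hsmooth ω).contDiff_space i (ha.trans_le ht.1), hZ,
    fun ω x i j k => hb ω t ht x i j k⟩⟩

/-- The time derivative of the density tested against a function of the velocity. -/
theorem integral_mul_deriv_time (hν : 0 ≤ ν) (hα : 1 / 2 < α)
    (hU : ∀ x t, 0 ≤ t → Measurable (U x t))
    (hNS : ∀ ω, SolvesNavierStokes ν (fun x t => U x t ω) (fun x t => Pr x t ω) (fun x => U₀ x ω))
    (hsmooth : ∀ ω, SmoothDecaying (fun x t => U x t ω) (fun x t => Pr x t ω))
    (henv : HasDecayEnvelope μ α U) (hp : ∀ x t, 0 ≤ t → IsPDF μ (U x t) (fun u => p u x t))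
    (hpC : IsC121 p) {x : E3} {t : ℝ} (ht : 0 < t) {F : E3 → ℝ} (hF : ContDiff ℝ 1 F)
    (hc : HasCompactSupport F) :
    Integrable (fun ω => ∑ i, pd i F (U x t ω) * deriv (fun s => U x s ω i) t) μ ∧
      ∫ u, F u * deriv (fun s => p u x s) t
        = ∫ ω, ∑ i, pd i F (U x t ω) * deriv (fun s => U x s ω i) t ∂μ := by
  -- The interval [t/2, 2t] contains the ball of radius t/2 about t and stays away from time zero.
  obtain ⟨Z, hZ⟩ := isRandomSlice_of_envelope hU hsmooth henv (a := t / 2) (b := 2 * t)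
    (by linarith) (by linarith)
  have hball : ∀ s ∈ Metric.ball t (t / 2), s ∈ Icc (t / 2) (2 * t) := by
    intro s hs
    rw [Metric.mem_ball, Real.dist_eq, abs_lt] at hs
    constructor <;> linarith [hs.1, hs.2]
  have hpos : ∀ s ∈ Metric.ball t (t / 2), 0 < s := fun s hs =>
    lt_of_lt_of_le (by linarith) (hball s hs).1
  have ht2 : (0 : ℝ) < t / 2 := by linarith
  have hZt := hZ t (hball t (Metric.mem_ball_self ht2))
  have h1 := hasDerivAt_expectation (μ := μ) hF hc (s₀ := t) (r := t / 2)
    (γ := fun s ω => U x s ω) (γ' := fun s ω i => deriv (fun s => U x s ω i) s)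
    (W := fun ω => 3 * ν * Z ω + (36 * newtonConst α x + 3) * Z ω ^ 2) ht2
    (fun s hs => hU x s (hpos s hs).le)
    (fun ω i s hs => (hsmooth ω).hasDerivAt_time i x (hpos s hs))
    (fun ω i s hs => abs_deriv_velocity_le hν (hNS ω) (hsmooth ω) (hpos s hs) hα
      ((hZ s (hball s hs)).bound ω) i x)
    ((hZt.integrable_Z.const_mul _).add (hZt.integrable_Z_sq.const_mul _))
  have h2 := hasDerivAt_integral_mul_of_compactSupport (s₀ := t) (r := t / 2) hF.continuous hc
    (q := fun s u => p u x s) (q' := fun s u => deriv (fun s => p u x s) s) ht2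
    (fun s hs => (hpC.contDiff_slice (hpos s hs)).continuous.comp (f := fun u : E3 => (u, x))
      (by fun_prop))
    (fun u s hs => (hpC.hasDerivAt_time u x (hpos s hs)).differentiableAt.hasDerivAt)
    ((hpC.continuousOn_deriv_time x).mono (prod_mono (fun s hs => hpos s hs) subset_rfl))
  refine ⟨h1.1, h2.unique (h1.2.congr_of_eventuallyEq ?_)⟩
  filter_upwards [Metric.ball_mem_nhds t ht2] with s hs
  exact ((hp x s (hpos s hs).le).integral_comp (hU x s (hpos s hs).le)
    hF.continuous.measurable).symm

/-- The subtracted U(x,t) does not depend on y and disappears on differentiation. The point y is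
left free, so that a second derivative can be taken before setting y = x. -/
theorem isCondExpGiven_coeffB {Z : Ω → ℝ} {t : ℝ} (ht : 0 < t) (hα : 0 ≤ α)
    (hv : IsRandomSlice μ α Z fun ω y => U y t ω) (hρ : IsCondIncrement μ U ρ)
    (hreg : IsRegular ρ) (i k : Fin 3) (x y : E3) :
    IsCondExpGiven μ (U x t) (fun ω => pd k (fun y => U y t ω i) y)
      (fun u => pd k (fun y => ρ x y u t i) y) := by
  have h := IsCondExpGiven.deriv_param (k := k) (hv.measurable x) (fun y => hρ x y t ht i)
    hv.integrable_Z (fun ω => (hv.twiceDifferentiable ω i).1.sub_const _)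
    (fun ω y => by
      rw [pd_sub_const]; exact ((hv.bound ω).le hα y i k k).2.1)
    (fun u => (hreg.twiceDifferentiable x u t ht i).1) y
  simpa only [pd_sub_const] using h

theorem isCondExpGiven_coeffA {Z : Ω → ℝ} {t : ℝ} (ht : 0 < t) (hα : 0 ≤ α)
    (hv : IsRandomSlice μ α Z fun ω y => U y t ω) (hρ : IsCondIncrement μ U ρ)
    (hreg : IsRegular ρ) (i : Fin 3) (x : E3) :
    IsCondExpGiven μ (U x t) (fun ω => lap (fun y => U y t ω i) x)
      (fun u => coeffA ρ i x u t) :=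
  IsCondExpGiven.sum _ (fun k _ => IsCondExpGiven.deriv_param (k := k) (hv.measurable x)
    (fun y => isCondExpGiven_coeffB ht hα hv hρ hreg i k x y) hv.integrable_Z
    (fun ω => (hv.twiceDifferentiable ω i).differentiable_pd k)
    (fun ω y => ((hv.bound ω).le hα y i k k).2.2)
    (fun u => (hreg.twiceDifferentiable x u t ht i).differentiable_pd k) x) (hv.measurable x)

theorem isCondExpGiven_condMean {Z : Ω → ℝ} {t : ℝ} (ht : 0 < t) (hα : 0 ≤ α)
    (hv : IsRandomSlice μ α Z fun ω y => U y t ω) (hρ : IsCondIncrement μ U ρ)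
    (i : Fin 3) (x y : E3) :
    IsCondExpGiven μ (U x t) (fun ω => U y t ω i) (fun u => condMean ρ x y u t i) := by
  have h := (hρ x y t ht i).add (IsCondExpGiven.self (g := fun u : E3 => u i) (hv.measurable x)
    (contDiff_coord (n := 1) i).continuous.measurable
    ((hv.memLp_coord hα x i).integrable (by norm_num)))
  simpa only [sub_add_cancel, condMean] using h

theorem isCondExpGiven_second_moment {Z : Ω → ℝ} {t : ℝ} (ht : 0 < t) (hα : 0 ≤ α)
    (hv : IsRandomSlice μ α Z fun ω y => U y t ω) (hρ : IsCondIncrement μ U ρ)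
    (hσ : IsCondCovariance μ U ρ σ) (x : E3) (j k : Fin 3) (y : E3) :
    IsCondExpGiven μ (U x t) (fun ω => U y t ω j * U y t ω k)
      (fun u => σ x y u t j k + condMean ρ x y u t j * condMean ρ x y u t k) :=
  IsCondExpGiven.second_moment (hv.measurable x) (isCondExpGiven_condMean ht hα hv hρ j x y)
    (isCondExpGiven_condMean ht hα hv hρ k x y) (hv.memLp_coord hα y j) (hv.memLp_coord hα y k)
    (hσ x y t ht j k)

/-- Two densities of the same law agree almost everywhere. Continuity of paths at time zero and
bounded convergence give the weak limit. -/
theorem initial_density (hU : ∀ x t, 0 ≤ t → Measurable (U x t))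
    (hNS : ∀ ω, SolvesNavierStokes ν (fun x t => U x t ω) (fun x t => Pr x t ω) (fun x => U₀ x ω))
    (hsmooth : ∀ ω, SmoothDecaying (fun x t => U x t ω) (fun x t => Pr x t ω))
    {p₀ : E3 → E3 → ℝ} (hp : ∀ x t, 0 ≤ t → IsPDF μ (U x t) (fun u => p u x t))
    (hp₀ : ∀ x, IsPDF μ (U₀ x) (fun u => p₀ u x)) (x : E3) :
    ((fun u => p u x 0) =ᵐ[volume] fun u => p₀ u x) ∧
    ∀ F : BoundedContinuousFunction E3 ℝ,
      Tendsto (fun t => ∫ u, F u * p u x t) (𝓝[>] 0) (𝓝 (∫ u, F u * p₀ u x)) := by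
  have h0 : U x 0 = U₀ x := funext fun ω => (hNS ω).initial x
  have hU0 : Measurable (U₀ x) := h0 ▸ hU x 0 le_rfl
  refine ⟨(h0 ▸ hp x 0 le_rfl : IsPDF μ (U₀ x) fun u => p u x 0).ae_eq (hp₀ x), fun F => ?_⟩
  rw [← (hp₀ x).integral_comp hU0 F.continuous.measurable]
  have e : (fun t => ∫ u, F u * p u x t) =ᶠ[𝓝[>] 0] fun t => ∫ ω, F (U x t ω) ∂μ := by
    filter_upwards [self_mem_nhdsWithin] with t ht
    rw [(hp x t (le_of_lt ht)).integral_comp (hU x t (le_of_lt ht)) F.continuous.measurable]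
  refine Tendsto.congr' e.symm ?_
  refine tendsto_integral_filter_of_dominated_convergence (fun _ => ‖F‖) ?_ ?_
    (integrable_const _) (Eventually.of_forall fun ω => ?_)
  · filter_upwards [self_mem_nhdsWithin] with t ht
    exact (F.continuous.measurable.comp (hU x t (le_of_lt ht))).aestronglyMeasurable
  · exact Eventually.of_forall fun t => Eventually.of_forall fun ω => F.norm_coe_le_norm _
  · rw [← h0]
    refine (F.continuous.tendsto _).comp ?_
    have h1 := (hsmooth ω).velocity_continuous (x, 0) ⟨trivial, self_mem_Ici⟩
    have h2 : Tendsto (fun t : ℝ => (x, t)) (𝓝[>] 0) (𝓝[univ ×ˢ Ici 0] (x, 0)) := by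
      refine tendsto_nhdsWithin_iff.2 ⟨?_, ?_⟩
      · have : Continuous fun t : ℝ => (x, t) := by fun_prop
        exact (this.tendsto 0).mono_left nhdsWithin_le_nhds
      · filter_upwards [self_mem_nhdsWithin] with t ht
        exact ⟨trivial, le_of_lt (mem_Ioi.1 ht)⟩
    exact Tendsto.comp (g := fun z : E3 × ℝ => U z.1 z.2 ω) h1 h2

end

end TurbPDF

/-! ### Assembly of the theorem -/

open TurbPDF in
theorem mainTheorem1 {Ω : Type*} [MeasurableSpace Ω] (μ : Measure Ω) [IsProbabilityMeasure μ]
    (ν : ℝ) (hν : 0 ≤ ν)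
    -- velocity, pressure and initial velocity
    (U : E3 → ℝ → Ω → E3) (Pr : E3 → ℝ → Ω → ℝ) (U₀ : E3 → Ω → E3)
    (hU : ∀ x t, 0 ≤ t → Measurable (U x t))
    (hNS : ∀ ω, SolvesNavierStokes ν (fun x t => U x t ω) (fun x t => Pr x t ω) (fun x => U₀ x ω))
    (hsmooth : ∀ ω, SmoothDecaying (fun x t => U x t ω) (fun x t => Pr x t ω))
    (α : ℝ) (hα : 1 / 2 < α) (henv : HasDecayEnvelope μ α U)
    -- conditional average increment and conditional covariance
    (ρ : E3 → E3 → E3 → ℝ → E3) (σ : E3 → E3 → E3 → ℝ → Fin 3 → Fin 3 → ℝ)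
    (hρ : IsCondIncrement μ U ρ) (hσ : IsCondCovariance μ U ρ σ)
    (hreg : IsRegular ρ)
    (hB : ∀ i k : Fin 3, ∀ t, 0 < t → ContDiff ℝ 1 (fun z : E3 × E3 => coeffB ρ i k z.1 z.2 t))
    (hσ₂ : ∀ x u t, 0 < t → ∀ j k : Fin 3, TwiceDifferentiable (fun y => σ x y u t j k))
    -- the one-point densities
    (p : E3 → E3 → ℝ → ℝ) (p₀ : E3 → E3 → ℝ)
    (hp : ∀ x t, 0 ≤ t → IsPDF μ (U x t) (fun u => p u x t))
    (hp₀ : ∀ x, IsPDF μ (U₀ x) (fun u => p₀ u x))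
    (hpC : IsC121 p) :
    (∀ x t, 0 < t →
      -- the integral `Q` converges, and the flux is locally integrable
      (∀ᵐ u ∂(μ.map (U x t)), ∀ i : Fin 3, Integrable (integrandQ ρ σ i x u t)) ∧
      (∀ i : Fin 3, LocallyIntegrable (fun u => flux ν ρ σ p i u x t)) ∧
      -- the equation, tested against smooth compactly supported functions of `u`
      (∀ F : E3 → ℝ, ContDiff ℝ (⊤ : ℕ∞) F → HasCompactSupport F →
        ∫ u, F u * transportPart ν p u x t
          = - ∫ u, ∑ i : Fin 3, pd i F u * flux ν ρ σ p i u x t) ∧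
      -- the equation, pointwise wherever the flux is differentiable in `u`
      (∀ u, (∀ i : Fin 3, DifferentiableAt ℝ (fun u' => flux ν ρ σ p i u' x t) u) →
        deriv (fun s => p u x s) t + ∑ i : Fin 3, u i * pd i (fun x' => p u x' t) x
          = ν * lap (fun x' => p u x' t) x
            + ∑ i : Fin 3, pd i (fun u' => flux ν ρ σ p i u' x t) u)) ∧
    -- the initial condition
    (∀ x, (fun u => p u x 0) =ᵐ[volume] (fun u => p₀ u x)) ∧
    (∀ x, ∀ F : BoundedContinuousFunction E3 ℝ,
      Tendsto (fun t => ∫ u, F u * p u x t) (𝓝[>] 0) (𝓝 (∫ u, F u * p₀ u x))) := by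
  have hα0 : 0 ≤ α := by linarith
  refine ⟨fun x t ht => ?_, fun x => (initial_density hU hNS hsmooth hp hp₀ x).1,
    fun x => (initial_density hU hNS hsmooth hp hp₀ x).2⟩
  obtain ⟨Z, hZ⟩ := isRandomSlice_of_envelope hU hsmooth henv ht le_rfl
  have hv := hZ t ⟨le_rfl, le_rfl⟩
  have hcm : ∀ u j, TwiceDifferentiable fun y => condMean ρ x y u t j := fun u j =>
    (hreg.twiceDifferentiable x u t ht j).add_const (u j)
  have hQ := fun i => hv.condExp_newton hα (hv.measurable x)
    (M := fun j k y u => σ x y u t j k + condMean ρ x y u t j * condMean ρ x y u t k)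
    (isCondExpGiven_second_moment ht hα0 hv hρ hσ x)
    (fun j k u => (hσ₂ x u t ht j k).add ((hcm u j).mul (hcm u k))) i x
  -- Nothing is assumed about the dependence of P on ω. Integrability of the pressure gradient as a
  -- random variable comes from this representation by the velocity.
  have hgrad : ∀ i ω, pd i (fun y => Pr y t ω) x
      = ∫ y : E3, (y i - x i) / (4 * Real.pi * ‖y - x‖ ^ 3) * quadSource (fun y => U y t ω) y :=
    fun i ω => pd_pressure (hNS ω) (hsmooth ω) ht hα (hv.bound ω) i x
  have hqC := hpC.contDiff_slice ht
  have hq : ∀ x, IsPDF μ (fun ω => U x t ω) fun u => p u x t := fun x => hp x t ht.le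
  have hA := fun i => isCondExpGiven_coeffA ht hα0 hv hρ hreg i x
  have hG : ∀ i : Fin 3, LocallyIntegrable (fun u => flux ν ρ σ p i u x t) := fun i =>
    hv.locallyIntegrable_flux (q := fun u x => p u x t) (b := fun k x u => coeffB ρ i k x u t)
      (hq x) hqC (fun k => hB i k t ht) (hA i) (hQ i).2.1
  have hweak : ∀ F : E3 → ℝ, ContDiff ℝ (⊤ : ℕ∞) F → HasCompactSupport F →
      ∫ u, F u * transportPart ν p u x t
        = - ∫ u, ∑ i : Fin 3, pd i F u * flux ν ρ σ p i u x t := by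
    intro F hF hc
    have hdt := integral_mul_deriv_time hν hα hU hNS hsmooth henv hp hpC (x := x) ht
      (hF.of_le (by exact_mod_cast le_top)) hc
    exact hv.weak_equation hα0 (q := fun u x => p u x t)
      (b := fun i k x u => coeffB ρ i k x u t) hq hqC (fun u => hpC.second u t ht)
      (fun k => hpC.continuous_pd_pd ht k k) (fun i k => hB i k t ht)
      (fun i k x => isCondExpGiven_coeffB ht hα0 hv hρ hreg i k x x) hA
      (Q := fun i u => coeffQ ρ σ i x u t)
      (dt := fun ω i => deriv (fun s => U x s ω i) t) (gP := fun ω i => pd i (fun y => Pr y t ω) x)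
      (fun i => by simpa only [hgrad] using (hQ i).2.2.1) (fun i => (hQ i).2.1)
      (fun i φ hφ hφb => by simp only [hgrad]; exact (hQ i).2.2.2 φ hφ hφb)
      (fun ω => (hNS ω).incompressible x t ht) (fun ω i => (hNS ω).momentum x t ht i)
      (hpC.continuous_deriv_time x ht) (by exact_mod_cast contDiff_infty.1 hF 2) hc hdt.1 hdt.2
  refine ⟨ae_all_iff.2 fun i => (hQ i).1, hG, hweak, fun u hd => ?_⟩
  have h := eq_divergence_of_weak (hpC.continuous_transportPart ν x ht) hG hweak hd
  rw [← h, transportPart]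
  ring
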